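/- **Theorem (Convergence Lemma).** Let $X$ be a complex Banach space, $\omega\ge 0$, and let $v:\mathbb R\to[1,\infty)$ be strongly admissible, i.e. measurable with $\sup_{s,t}\frac{v(s+t)}{v(s)+v(t)}<\infty$ and $\frac1v\in L^2(\mathbb R)$. *Function spaces.* Let $\mathrm{St}_\theta=\{z\in\mathbb C: |\operatorname{Im} z|<\theta\}$ for $\theta>0$ and $\mathrm{St}_0=\mathbb R$. Let $\mathrm W^2_v(\mathrm{St}_\omega)$ be the space of all functions $\hat g(z)=\int_{\mathbb R}e^{-isz}g(s)\,ds$ ($z\in \mathrm{St}_\omega$) with $g\in L^2(\mathbb R)$ and $v e^{\omega|\cdot|}g\in L^2(\mathbb R)$, normed by $\|\hat g\|_{\mathrm W^2_v(\mathrm{St}_\omega)}=\|v e^{\omega|\cdot|}g\|_{L^2}$; this is an algebra under pointwise multiplication. Let $\mathrm{H\ddot or}^2_v(\mathrm{St}_\omega)$ be the space of all $f:\mathrm{St}_\omega\to\mathbb C$ such that $e^{-(\cdot-t)^2}f\in \mathrm W^2_v(\mathrm{St}_\omega)$ for all $t\in\mathbb R$ and $\sup_{t\in\mathbb R}\|e^{-(\cdot-t)^2}f\|_{\mathrm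 W^2_v(\mathrm{St}_\omega)}<\infty$. Let $\mathrm H^\infty_0[\overline{\mathrm{St}}_\omega]$ be the set of functions $\psi$ that, for some $\theta>\omega$, are holomorphic on $\mathrm{St}_\theta$ with $\sup_{z\in \mathrm{St}_\theta}(1+|\operatorname{Re}z|)^\alpha|\psi(z)|<\infty$ for all $\alpha>0$, and let $\mathcal E[\overline{\mathrm{St}}_\omega]$ be the set of functions $\psi$ that, for some $\theta>\omega$, are bounded and holomorphic on $\mathrm{St}_\theta$ with $\sup_{|r|<\theta}\int_{\mathbb R}|\psi(s+ir)|\,ds<\infty$. *Functional calculus.* A linear operator $A$ on $X$ has a bounded $\mathrm W^2_v(\mathrm{St}_\omega)$-calculus if there is a bounded algebra homomorphism $\Psi:\mathrm W^2_v(\mathrm{St}_\omega)\to\mathcal L(X)$ with $\Psi((\lambda-\mathbf z)^{-1})=R(\lambda,A)$ for some $\lambda$ with $|\operatorname{Im}\lambda|>\omega$. For such $A$ and $\psi\in\mathcal E[\overline{\mathrm{St}}_\omega]$ (with associated $\theta$) let $\psi(A)=\frac1{2\pi i}\int_{\partial \mathrm{St}_\delta}\psi(w)R(w,A)\,dw\in\mathcal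 L(X)$, where $\omega<\delta<\theta$. The closure of the map $\psi\mapsto\psi(A)$ in $\mathrm W^2_v(\mathrm{St}_\omega)\times\mathcal L(X)$ is the elementary Sobolev calculus $e\mapsto e(A)$. For $f:\mathrm{St}_\omega\to\mathbb C$ let $[f]$ be the set of all $e$ such that $e$ and $ef$ belong to the domain of the elementary Sobolev calculus; the (possibly unbounded) operator $f(A)$ is defined by: $f(A)x=y$ if and only if $e(A)y=(ef)(A)x$ for all $e\in[f]$ (this is single-valued if $\bigcap_{e\in[f]}\ker e(A)=\{0\}$, as is the case for $f\in\mathrm{H\ddot or}^2_v(\mathrm{St}_\omega)$). A set $\mathcal D\subseteq\mathcal E[\overline{\mathrm{St}}_\omega]$ is ample if $\overline{\operatorname{span}}\bigcup_{\psi\in\mathcal D}\operatorname{ran}\psi(A)=X$. *Statement.* Let $A$ be an operator on $X$ with a bounded $\mathrm W^2_v(\mathrm{St}_\omega)$-calculus. Let $f\in\mathrm{H\ddot or}^2_v(\mathrm{St}_\omega)$ and let $(f_n)_n$ be a sequence in $\mathrm{H\ddot or}^2_v(\mathrm{St}_\omega)$ such that 1. there is an ample set $\mathcal D\subseteq\mathrm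 H^\infty_0[\overline{\mathrm{St}}_\omega]$ with $\|\psi(f_n-f)\|_{\mathrm W^2_v(\mathrm{St}_\omega)}\to0$ as $n\to\infty$ for all $\psi\in\mathcal D$; 2. $f_n(A)\in\mathcal L(X)$ for all $n$ and $\sup_n\|f_n(A)\|<\infty$. Then $f(A)\in\mathcal L(X)$ and $f_n(A)\to f(A)$ strongly on $X$. -/

import Mathlib

open MeasureTheory Filter Topology
open scoped ENNReal NNReal

noncomputable section

namespace HorCalc

/-! ### Weights -/

/-- Strongly admissible weights `v : ℝ → [1, ∞)`: measurable, `v (s + t) ≤ M (v s + v t)` for some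
constant `M`, and `1 / v ∈ L²(ℝ)`. -/
structure StronglyAdmissible (v : ℝ → ℝ) : Prop where
  measurable : Measurable v
  one_le : ∀ s, 1 ≤ v s
  subadd : ∃ M : ℝ, ∀ s t, v (s + t) ≤ M * (v s + v t)
  inv_memLp : MemLp (fun s => 1 / v s) 2 volume

/-! ### Strips and function spaces on strips -/

/-- The open horizontal strip `{z : |Im z| < θ}`. -/
def openStrip (θ : ℝ) : Set ℂ := {z | |z.im| < θ}

/-- The strip `St_ω`, which is the open strip of height `ω` if `ω > 0` and the real line if
`ω = 0`. -/
def strip (ω : ℝ) : Set ℂ := if ω = 0 then {z | z.im = 0} else openStrip ω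

/-- The function `v(s) e^{ω|s|} g(s)`. -/
def weighted (v : ℝ → ℝ) (ω : ℝ) (g : ℝ → ℂ) : ℝ → ℂ :=
  fun s => ((v s * Real.exp (ω * |s|) : ℝ) : ℂ) * g s

/-- `g ∈ L²_{v,ω}(ℝ)`. -/
def MemWeightedL2 (v : ℝ → ℝ) (ω : ℝ) (g : ℝ → ℂ) : Prop :=
  MemLp g 2 volume ∧ MemLp (weighted v ω g) 2 volume

/-- The (Fourier) transform `ĝ(z) = ∫ e^{-i s z} g(s) ds`, as a function on `St_ω`. -/
def fourierStrip (ω : ℝ) (g : ℝ → ℂ) : strip ω → ℂ :=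
  fun z => ∫ s : ℝ, Complex.exp (-Complex.I * s * (z : ℂ)) * g s

theorem abs_im_le_of_mem_strip {ω : ℝ} {z : ℂ} (hz : z ∈ strip ω) : |z.im| ≤ ω := by
  unfold strip at hz
  split_ifs at hz with h
  · have h0 : z.im = 0 := hz
    simp [h0, h]
  · exact le_of_lt hz

/-- For strongly admissible `v` and `g ∈ L²_{v,ω}(ℝ)` the integral defining `ĝ` converges
absolutely at each point of the strip. -/
theorem integrable_fourierStrip {v : ℝ → ℝ} (hv : StronglyAdmissible v) {ω : ℝ} {g : ℝ → ℂ}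
    (hg : MemWeightedL2 v ω g) (z : strip ω) :
    Integrable (fun s : ℝ => Complex.exp (-Complex.I * s * (z : ℂ)) * g s) volume := by
  have h1 : Integrable (fun s => (1 / v s) * ‖weighted v ω g s‖) volume :=
    hv.inv_memLp.integrable_mul hg.2.norm
  refine h1.mono' ?_ ?_
  · refine AEStronglyMeasurable.mul ?_ hg.1.1
    exact (by fun_prop : Continuous fun s : ℝ =>
      Complex.exp (-Complex.I * s * (z : ℂ))).aestronglyMeasurable
  · refine Eventually.of_forall fun s => ?_
    have hpos : 0 < v s := lt_of_lt_of_le one_pos (hv.one_le s)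
    have hz := abs_im_le_of_mem_strip z.2
    have e1 : ‖Complex.exp (-Complex.I * s * (z : ℂ))‖ = Real.exp (s * (z : ℂ).im) := by
      rw [Complex.norm_exp]; congr 1; simp
    have e2 : s * (z : ℂ).im ≤ ω * |s| := by
      calc s * (z : ℂ).im ≤ |s * (z : ℂ).im| := le_abs_self _
        _ = |(z : ℂ).im| * |s| := by rw [abs_mul, mul_comm]
        _ ≤ ω * |s| := mul_le_mul_of_nonneg_right hz (abs_nonneg _)
    have e3 : (1 / v s) * ‖weighted v ω g s‖ = Real.exp (ω * |s|) * ‖g s‖ := by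
      unfold weighted
      rw [norm_mul, Complex.norm_real, Real.norm_of_nonneg (by positivity)]
      field_simp
    rw [e3, norm_mul, e1]
    exact mul_le_mul_of_nonneg_right (Real.exp_le_exp.2 e2) (norm_nonneg _)

/-- The generalized Sobolev space `W²_v(St_ω) = {ĝ : g ∈ L²_{v,ω}(ℝ)}`, as a space of functions on
`St_ω`. (If `ω = 0` its elements are the continuous representatives.) -/
def sobolevSpace {v : ℝ → ℝ} (hv : StronglyAdmissible v) (ω : ℝ) :
    Submodule ℂ (strip ω → ℂ) where
  carrier := {f | ∃ g, MemWeightedL2 v ω g ∧ f = fourierStrip ω g}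
  zero_mem' := by
    refine ⟨0, ⟨MemLp.zero, ?_⟩, ?_⟩
    · have h : weighted v ω 0 = 0 := by funext s; simp [weighted]
      rw [h]; exact MemLp.zero
    · funext z; simp [fourierStrip]
  add_mem' := by
    rintro _ _ ⟨g, hg, rfl⟩ ⟨h, hh, rfl⟩
    refine ⟨g + h, ⟨hg.1.add hh.1, ?_⟩, ?_⟩
    · have e : weighted v ω (g + h) = weighted v ω g + weighted v ω h := by
        funext s; simp [weighted, mul_add]
      rw [e]; exact hg.2.add hh.2
    · funext z
      simp only [fourierStrip, Pi.add_apply, mul_add]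
      exact (integral_add (integrable_fourierStrip hv hg z)
        (integrable_fourierStrip hv hh z)).symm
  smul_mem' := by
    rintro c _ ⟨g, hg, rfl⟩
    refine ⟨c • g, ⟨hg.1.const_smul c, ?_⟩, ?_⟩
    · have e : weighted v ω (c • g) = c • weighted v ω g := by
        funext s; simp [weighted, mul_left_comm]
      rw [e]; exact hg.2.const_smul c
    · funext z
      simp only [fourierStrip, Pi.smul_apply, smul_eq_mul, mul_left_comm _ c]
      exact (integral_const_mul c _).symm

/-- The norm `‖ĝ‖_{W²_v(St_ω)} = ‖v e^{ω|·|} g‖_{L²}`, extended by the value `∞` to functions that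
do not belong to `W²_v(St_ω)`. (The function `g` is determined almost everywhere by `ĝ`.) -/
def sobolevNorm (v : ℝ → ℝ) (ω : ℝ) (f : strip ω → ℂ) : ℝ≥0∞ :=
  ⨅ (g : ℝ → ℂ) (_ : MemWeightedL2 v ω g ∧ f = fourierStrip ω g), eLpNorm (weighted v ω g) 2 volume

/-- The Gaussian function `e^{-z²}`. -/
def gauss (z : ℂ) : ℂ := Complex.exp (-z ^ 2)

/-- The Hörmander norm `sup_t ‖τ_t G · f‖_{W²_v(St_ω)}`, where `G` is the Gaussian. -/
def horNorm (v : ℝ → ℝ) (ω : ℝ) (f : strip ω → ℂ) : ℝ≥0∞ :=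
  ⨆ t : ℝ, sobolevNorm v ω (fun z => gauss ((z : ℂ) - t) * f z)

/-- The generalized Hörmander space `Hör²_v(St_ω)`. -/
def horSpace (v : ℝ → ℝ) (ω : ℝ) : Set (strip ω → ℂ) := {f | horNorm v ω f < ∞}

/-- Restriction to `St_ω` of a function given on a larger set. -/
def toStrip (ω : ℝ) (ψ : ℂ → ℂ) : strip ω → ℂ := fun z => ψ z

/-- The holomorphic Schwartz functions on the open strip of height `θ`. -/
def holSchwartz (θ : ℝ) : Set (ℂ → ℂ) :=
  {ψ | DifferentiableOn ℂ ψ (openStrip θ) ∧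
    ∀ α : ℝ, 0 < α → ∃ C : ℝ, ∀ z ∈ openStrip θ, ‖ψ z‖ ≤ C / (1 + |z.re|) ^ α}

/-- The union of the spaces `holSchwartz θ` over all `θ > ω`. -/
def holSchwartzGerm (ω : ℝ) : Set (ℂ → ℂ) := {ψ | ∃ θ, ω < θ ∧ ψ ∈ holSchwartz θ}

/-- Elementary functions `𝓔(St_θ) = H^∞(St_θ) ∩ H¹(St_θ)`. -/
def elementary (θ : ℝ) : Set (ℂ → ℂ) :=
  {ψ | DifferentiableOn ℂ ψ (openStrip θ) ∧
    (∃ C : ℝ, ∀ z ∈ openStrip θ, ‖ψ z‖ ≤ C) ∧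
    (⨆ (r : ℝ) (_ : |r| < θ), ∫⁻ s : ℝ, ‖ψ ((s : ℂ) + (r : ℂ) * Complex.I)‖ₑ) < ∞}

/-- The union of the spaces `elementary θ` over all `θ > ω`. -/
def elementaryGerm (ω : ℝ) : Set (ℂ → ℂ) := {ψ | ∃ θ, ω < θ ∧ ψ ∈ elementary θ}

/-! ### Operators and functional calculus -/

variable {X : Type*} [NormedAddCommGroup X] [NormedSpace ℂ X]

/-- `R` is the (bounded, everywhere defined) inverse of `l - A`. -/
def IsResolventAt (A : X →ₗ.[ℂ] X) (l : ℂ) (R : X →L[ℂ] X) : Prop :=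
  (∀ x : X, ∃ h : R x ∈ A.domain, l • R x - A ⟨R x, h⟩ = x) ∧
    ∀ x : A.domain, R (l • (x : X) - A x) = x

open Classical in
/-- The resolvent `R(l, A)` for `l` in the resolvent set of `A` (and `0` otherwise). -/
def resolventOp (A : X →ₗ.[ℂ] X) (l : ℂ) : X →L[ℂ] X :=
  if h : ∃ R, IsResolventAt A l R then h.choose else 0

/-- `A` has a bounded `W²_v(St_ω)`-calculus: there is a bounded algebra homomorphism
`Ψ : W²_v(St_ω) → L(X)` with `Ψ((l - z)⁻¹) = R(l, A)` for some `l` with `|Im l| > ω`. (As `v` is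
strongly admissible, `W²_v(St_ω)` is closed under pointwise products, so `h` below always exists.) -/
def HasBoundedSobolevCalculus {v : ℝ → ℝ} (hv : StronglyAdmissible v) (ω : ℝ)
    (A : X →ₗ.[ℂ] X) : Prop :=
  ∃ Ψ : sobolevSpace hv ω →ₗ[ℂ] (X →L[ℂ] X),
    (∀ f g h : sobolevSpace hv ω, (h : strip ω → ℂ) = (f : strip ω → ℂ) * (g : strip ω → ℂ) →
      Ψ h = Ψ f * Ψ g) ∧
    (∃ C : ℝ≥0, ∀ f : sobolevSpace hv ω, ‖Ψ f‖ₑ ≤ C * sobolevNorm v ω f) ∧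
    ∃ l : ℂ, ω < |l.im| ∧ ∃ r : sobolevSpace hv ω,
      (r : strip ω → ℂ) = (fun z : strip ω => (l - (z : ℂ))⁻¹) ∧ IsResolventAt A l (Ψ r)

/-- The Cauchy integral `(2πi)⁻¹ ∫ ψ(w) R(w, A) dw` over the positively oriented boundary of the
strip of height `δ`. -/
def cauchyOp (A : X →ₗ.[ℂ] X) (δ : ℝ) (ψ : ℂ → ℂ) : X →L[ℂ] X :=
  (2 * (Real.pi : ℂ) * Complex.I)⁻¹ •
    ((∫ s : ℝ, ψ ((s : ℂ) - (δ : ℂ) * Complex.I) •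
        resolventOp A ((s : ℂ) - (δ : ℂ) * Complex.I)) -
      ∫ s : ℝ, ψ ((s : ℂ) + (δ : ℂ) * Complex.I) •
        resolventOp A ((s : ℂ) + (δ : ℂ) * Complex.I))

open Classical in
/-- The elementary calculus `ψ ↦ ψ(A)` on elementary functions (and `0` otherwise): the Cauchy
integral over the boundary of a strip of height `δ`, where `ω < δ < θ` and `ψ ∈ 𝓔(St_θ)`. By
Cauchy's theorem, the value does not depend on the choice of `δ` if `A` is of strip type. -/
def elemCalc (ω : ℝ) (A : X →ₗ.[ℂ] X) (ψ : ℂ → ℂ) : X →L[ℂ] X :=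
  if h : ∃ δ, ω < δ ∧ ∃ θ, δ < θ ∧ ψ ∈ elementary θ then cauchyOp A h.choose ψ else 0

/-- A set `D` of elementary functions is ample if the ranges of the operators `ψ(A)`, `ψ ∈ D`, span
a dense subspace. -/
def Ample (ω : ℝ) (A : X →ₗ.[ℂ] X) (D : Set (ℂ → ℂ)) : Prop :=
  D ⊆ elementaryGerm ω ∧
    closure (Submodule.span ℂ (⋃ ψ ∈ D, Set.range (elemCalc ω A ψ)) : Set X) = Set.univ

/-- The elementary Sobolev calculus: the closure of (the graph of) the elementary calculus in
`W²_v(St_ω) × L(X)`. -/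
def SobolevCalc {v : ℝ → ℝ} (hv : StronglyAdmissible v) (ω : ℝ) (A : X →ₗ.[ℂ] X)
    (f : strip ω → ℂ) (T : X →L[ℂ] X) : Prop :=
  f ∈ sobolevSpace hv ω ∧ ∃ ψ : ℕ → ℂ → ℂ, (∀ n, ψ n ∈ elementaryGerm ω) ∧
    Tendsto (fun n => sobolevNorm v ω (toStrip ω (ψ n) - f)) atTop (𝓝 0) ∧
    Tendsto (fun n => elemCalc ω A (ψ n)) atTop (𝓝 T)

/-- The operator `f(A)`, identified with its graph, for a function `f` on `St_ω`. It is defined by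
algebraic extension of the elementary Sobolev calculus: `f(A) x = y` if and only if
`e(A) y = (e f)(A) x` for all functions `e` such that `e` and `e f` belong to the domain of the
elementary Sobolev calculus. This relation is single-valued if and only if the operators `e(A)` for
these `e` have no common kernel, i.e. if `f` belongs to the domain of the extended calculus. -/
def funCalc {v : ℝ → ℝ} (hv : StronglyAdmissible v) (ω : ℝ) (A : X →ₗ.[ℂ] X)
    (f : strip ω → ℂ) : Submodule ℂ (X × X) where
  carrier := {p | ∀ (e : strip ω → ℂ) (T S : X →L[ℂ] X),
    SobolevCalc hv ω A e T → SobolevCalc hv ω A (e * f) S → T p.2 = S p.1}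
  zero_mem' := by intro e T S _ _; simp
  add_mem' := by
    intro p q hp hq e T S h1 h2
    simp [hp e T S h1 h2, hq e T S h1 h2]
  smul_mem' := by
    intro c p hp e T S h1 h2
    simp [hp e T S h1 h2]

/-- `f(A) ∈ L(X)`, and `f(A) = T`. -/
def FunCalcEq {v : ℝ → ℝ} (hv : StronglyAdmissible v) (ω : ℝ) (A : X →ₗ.[ℂ] X)
    (f : strip ω → ℂ) (T : X →L[ℂ] X) : Prop :=
  funCalc hv ω A f = LinearMap.graph (T : X →ₗ[ℂ] X)

end HorCalc

end

noncomputable section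

namespace HorCalc

/-! ### Growth of weights -/

namespace StronglyAdmissible

/-! Let `Ψ` be a bounded calculus for `A` and `G = e^{-z²}`. The Gaussian regularizes every
Hörmander function `f`: `G f` lies in the Sobolev space. Since `Ψ G` is injective, a bounded
operator `S` equals `f(A)` exactly when `Ψ(G) S = Ψ(G f)` (`funCalcEq`, `gauss_apply_of_funCalcEq`).
For `ψ ∈ D` put `u = ψ(A) y` and `E n = ψ (F n - f)`. The identity `G (F n) ψ = G f ψ + G (E n)` and
multiplicativity give `Ψ(G) (T n u - Ψ(E n) y) = Ψ(G f) u`. By injectivity the vector `T n u - Ψ(E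
n) y` is the same for all large `n`; as `Ψ(E n) → 0`, it is the limit of `T n u`
(`exists_tendsto_apply`). Boundedness of `T n` and ampleness of `D` extend the convergence to all of
`X`, and the limit operator `S` satisfies `Ψ(G) S = Ψ(G f)` on a dense subspace, hence everywhere.

The remaining work relates `Ψ` to the operators built from resolvents. The Sobolev space is an image
of `L²(ℝ)`, where the Cauchy integral of resolvent kernels converges as a Bochner integral. Point
evaluations identify this integral with `ψ` by Cauchy's formula on a strip, and `Ψ` turns it into
`ψ(A)` (`exists_eq_cauchyOp`). Modulated Gaussians are total (`span_modGaussL2_dense`), so the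
closure of the elementary calculus is all of `Ψ`; totality also yields the injectivity of `Ψ G`
(`injective_gauss`). The weight enters through subexponential growth, which puts resolvent kernels
and Gaussians into the space, and through `1 / v ∈ L²`, which makes products and evaluations bounded
operations. -/

theorem exists_subadd {v : ℝ → ℝ} (hv : StronglyAdmissible v) :
    ∃ M : ℝ, 1 ≤ M ∧ ∀ s t, v (s + t) ≤ M * (v s + v t) := by
  obtain ⟨M, hM⟩ := hv.subadd
  refine ⟨max M 1, le_max_right _ _, fun s t => (hM s t).trans ?_⟩
  have := hv.one_le s
  have := hv.one_le t
  exact mul_le_mul_of_nonneg_right (le_max_left _ _) (by linarith)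

/-- A strongly admissible weight is bounded on bounded intervals. -/
theorem exists_bound {v : ℝ → ℝ} (hv : StronglyAdmissible v) {R : ℝ} (hR : 0 < R) :
    ∃ B : ℝ, 1 ≤ B ∧ ∀ t, |t| ≤ R → v t ≤ B := by
  obtain ⟨M, hM1, hM⟩ := hv.exists_subadd
  -- A Steinhaus-type argument: a sublevel set of `v` of more than half measure meets its own
  -- reflection.
  let E : ℕ → Set ℝ := fun n => Set.Icc (-(2 * R)) (2 * R) ∩ {s | v s ≤ n}
  have hEm : ∀ n, MeasurableSet (E n) := fun n =>
    measurableSet_Icc.inter (measurableSet_le hv.measurable measurable_const)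
  have hmono : Monotone E := fun m n hmn s hs =>
    ⟨hs.1, le_trans (show v s ≤ m from hs.2) (by exact_mod_cast hmn)⟩
  have hU : ⋃ n, E n = Set.Icc (-(2 * R)) (2 * R) := by
    ext s
    simp only [Set.mem_iUnion]
    refine ⟨fun ⟨n, hn⟩ => hn.1, fun hs => ?_⟩
    obtain ⟨n, hn⟩ := exists_nat_ge (v s)
    exact ⟨n, hs, hn⟩
  have hlim := tendsto_measure_iUnion_atTop (μ := (volume : Measure ℝ)) hmono
  rw [hU, Real.volume_Icc] at hlim
  have hlt : ENNReal.ofReal (3 * R) < ENNReal.ofReal (2 * R - -(2 * R)) := by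
    rw [ENNReal.ofReal_lt_ofReal_iff] <;> linarith
  obtain ⟨n, hn⟩ := (hlim.eventually (lt_mem_nhds hlt)).exists
  refine ⟨max (2 * M * n) 1, le_max_right _ _, fun t ht => le_trans ?_ (le_max_left _ _)⟩
  have htR := abs_le.1 ht
  have hpre : volume ((fun s => t - s) ⁻¹' E n) = volume (E n) :=
    (Measure.measurePreserving_sub_left volume t).measure_preimage (hEm n).nullMeasurableSet
  -- Both sets have measure above `3R` and lie in an interval of length `6R`, so they intersect. A
  -- common point `s` writes `t = s + (t - s)` with `v ≤ n` at both summands.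
  have hne : (E n ∩ (fun s => t - s) ⁻¹' E n).Nonempty := by
    by_contra hempty
    rw [Set.not_nonempty_iff_eq_empty, ← Set.disjoint_iff_inter_eq_empty] at hempty
    have hsum := measure_union (μ := (volume : Measure ℝ)) hempty
      ((measurable_const.sub measurable_id) (hEm n))
    have hsub : E n ∪ (fun s => t - s) ⁻¹' E n ⊆ Set.Icc (-(3 * R)) (3 * R) := by
      rintro s (hs | hs)
      · exact ⟨by linarith [hs.1.1], by linarith [hs.1.2]⟩
      · have h1 := hs.1.1
        have h2 := hs.1.2
        exact ⟨by linarith, by linarith⟩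
    have hle := measure_mono (μ := (volume : Measure ℝ)) hsub
    rw [hsum, hpre, Real.volume_Icc] at hle
    have h6 : ENNReal.ofReal (3 * R - -(3 * R)) = ENNReal.ofReal (3 * R) + ENNReal.ofReal (3 * R) := by
      rw [← ENNReal.ofReal_add (by positivity) (by positivity)]
      congr 1; ring
    rw [h6] at hle
    exact absurd hle (not_le.2 (ENNReal.add_lt_add hn hn))
  obtain ⟨s, hs1, hs2⟩ := hne
  have h1 : v s ≤ n := hs1.2
  have h2 : v (t - s) ≤ n := hs2.2
  have := hM s (t - s)
  rw [add_sub_cancel] at this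
  nlinarith

/-- Strongly admissible weights grow subexponentially. -/
theorem exists_le_exp {v : ℝ → ℝ} (hv : StronglyAdmissible v) {ε : ℝ} (hε : 0 < ε) :
    ∃ C : ℝ, 0 < C ∧ ∀ s, v s ≤ C * Real.exp (ε * |s|) := by
  obtain ⟨M, hM1, hM⟩ := hv.exists_subadd
  set q := Real.log (2 * M) with hq
  have hq0 : 0 < q := Real.log_pos (by linarith)
  -- With this step length, `(2M) ^ (|s| / R) = e^{ε|s|}`.
  set R := q / ε with hRdef
  have hR : 0 < R := by positivity
  obtain ⟨B, hB1, hB⟩ := hv.exists_bound hR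
  have key : ∀ n : ℕ, ∀ s : ℝ, |s| ≤ (n + 1) * R → v s ≤ B * (2 * M) ^ n := by
    intro n
    induction n with
    | zero => intro s hs; simpa using hB s (by simpa using hs)
    | succ n ih =>
      intro s hs
      have hn : (0 : ℝ) < n + 2 := by positivity
      push_cast at hs
      have hs' : |s| ≤ (n + 2) * R := by linarith
      have h1 : v (s / (n + 2)) ≤ B := by
        apply hB
        rw [abs_div, abs_of_pos hn, div_le_iff₀ hn]
        linarith
      have h2 : v (s * (n + 1) / (n + 2)) ≤ B * (2 * M) ^ n := by
        apply ih
        rw [abs_div, abs_of_pos hn, div_le_iff₀ hn, abs_mul, abs_of_pos (by positivity : (0:ℝ) < n + 1)]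
        nlinarith
      -- Cut `s` into one piece of length at most `R` and one of length at most `(n + 1) R`; each
      -- cut costs a factor `2M`.
      have h3 := hM (s / (n + 2)) (s * (n + 1) / (n + 2))
      have e : s / (n + 2) + s * (n + 1) / (n + 2) = s := by field_simp; ring
      rw [e] at h3
      have hp : 1 ≤ (2 * M) ^ n := one_le_pow₀ (by linarith)
      have h4 : B ≤ B * (2 * M) ^ n := le_mul_of_one_le_right (by linarith) hp
      calc v s ≤ M * (B * (2 * M) ^ n + B * (2 * M) ^ n) :=
            h3.trans (mul_le_mul_of_nonneg_left (by linarith) (by linarith))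
        _ = B * (2 * M) ^ (n + 1) := by ring
  refine ⟨B, by linarith, fun s => ?_⟩
  have hn := key ⌊|s| / R⌋₊ s (by
    have := (Nat.lt_floor_add_one (|s| / R)).le
    rwa [div_le_iff₀ hR] at this)
  refine hn.trans (mul_le_mul_of_nonneg_left ?_ (by linarith))
  rw [← Real.exp_log (by linarith : 0 < 2 * M), ← Real.exp_nat_mul, Real.exp_le_exp, ← hq]
  have := Nat.floor_le (by positivity : 0 ≤ |s| / R)
  calc (⌊|s| / R⌋₊ : ℝ) * q ≤ |s| / R * q := mul_le_mul_of_nonneg_right this hq0.le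
    _ = ε * |s| := by rw [hRdef]; field_simp

end StronglyAdmissible

/-- The weight `v(s) e^{ω|s|}`. -/
def weight (v : ℝ → ℝ) (ω s : ℝ) : ℝ := v s * Real.exp (ω * |s|)

theorem measurable_weight {v : ℝ → ℝ} (hv : StronglyAdmissible v) (ω : ℝ) :
    Measurable (weight v ω) :=
  hv.measurable.mul (by fun_prop)

theorem weight_pos {v : ℝ → ℝ} (hv : StronglyAdmissible v) (ω s : ℝ) : 0 < weight v ω s :=
  mul_pos (lt_of_lt_of_le one_pos (hv.one_le s)) (Real.exp_pos _)

theorem one_le_weight {v : ℝ → ℝ} (hv : StronglyAdmissible v) {ω : ℝ} (hω : 0 ≤ ω) (s : ℝ) :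
    1 ≤ weight v ω s :=
  one_le_mul_of_one_le_of_one_le (hv.one_le s) (Real.one_le_exp (by positivity))

theorem weighted_apply (v : ℝ → ℝ) (ω : ℝ) (g : ℝ → ℂ) (s : ℝ) :
    weighted v ω g s = (weight v ω s : ℂ) * g s := rfl

theorem norm_weighted {v : ℝ → ℝ} (hv : StronglyAdmissible v) (ω : ℝ) (g : ℝ → ℂ) (s : ℝ) :
    ‖weighted v ω g s‖ = weight v ω s * ‖g s‖ := by
  rw [weighted_apply, norm_mul, Complex.norm_real, Real.norm_of_nonneg (weight_pos hv ω s).le]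

theorem weight_le_exp {v : ℝ → ℝ} (hv : StronglyAdmissible v) (ω : ℝ) {ε : ℝ} (hε : 0 < ε) :
    ∃ C : ℝ, 0 < C ∧ ∀ s, weight v ω s ≤ C * Real.exp ((ω + ε) * |s|) := by
  obtain ⟨C, hC, h⟩ := hv.exists_le_exp hε
  refine ⟨C, hC, fun s => ?_⟩
  calc weight v ω s ≤ C * Real.exp (ε * |s|) * Real.exp (ω * |s|) :=
        mul_le_mul_of_nonneg_right (h s) (Real.exp_pos _).le
    _ = _ := by rw [mul_assoc, ← Real.exp_add]; ring_nf

theorem memLp_exp_neg_abs {ε : ℝ} (hε : 0 < ε) :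
    MemLp (fun s : ℝ => Real.exp (-ε * |s|)) 2 volume := by
  rw [memLp_two_iff_integrable_sq (by fun_prop)]
  have h : Integrable (fun s : ℝ => Real.exp (-(2 * ε) * |s|)) :=
    -- The Bochner integral of a non-integrable function is `0`, so a nonzero value proves
    -- integrability.
    .of_integral_ne_zero (by
      rw [integral_comp_abs (f := fun s => Real.exp (-(2 * ε) * s)),
        integral_exp_mul_Ioi (by linarith)]
      simp [hε.ne'])
  refine h.congr (Eventually.of_forall fun s => ?_)
  simp only
  rw [sq, ← Real.exp_add]
  ring_nf

theorem memLp_of_norm_le_exp {g : ℝ → ℂ} (hg : AEStronglyMeasurable g volume) {C ε : ℝ}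
    (hε : 0 < ε) (h : ∀ s, ‖g s‖ ≤ C * Real.exp (-ε * |s|)) : MemLp g 2 volume := by
  refine ((memLp_exp_neg_abs hε).const_mul C).mono hg (Eventually.of_forall fun s => ?_)
  exact (h s).trans (le_abs_self _)

/-- Functions which decay faster than `e^{-ω|s|}` belong to the weighted `L²`-space. -/
theorem memWeightedL2_of_norm_le_exp {v : ℝ → ℝ} (hv : StronglyAdmissible v) {ω : ℝ} (hω : 0 ≤ ω)
    {g : ℝ → ℂ} (hg : AEStronglyMeasurable g volume) {C δ : ℝ} (hδ : ω < δ)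
    (h : ∀ s, ‖g s‖ ≤ C * Real.exp (-δ * |s|)) : MemWeightedL2 v ω g := by
  refine ⟨memLp_of_norm_le_exp hg (hω.trans_lt hδ) h, ?_⟩
  -- Half of the gap `δ - ω` pays for the growth of `v`; the other half remains as decay.
  obtain ⟨K, hK, hw⟩ := weight_le_exp hv ω (by linarith : 0 < (δ - ω) / 2)
  have hC : 0 ≤ C := by
    have := (norm_nonneg _).trans (h 0)
    simpa using this
  refine memLp_of_norm_le_exp (C := K * C) (ε := (δ - ω) / 2) ?_ (by linarith) fun s => ?_
  · exact ((Complex.measurable_ofReal.comp (measurable_weight hv ω)).aestronglyMeasurable).mul hg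
  · rw [norm_weighted hv]
    calc weight v ω s * ‖g s‖
        ≤ (K * Real.exp ((ω + (δ - ω) / 2) * |s|)) * (C * Real.exp (-δ * |s|)) :=
          mul_le_mul (hw s) (h s) (norm_nonneg _) (by positivity)
      _ = K * C * (Real.exp ((ω + (δ - ω) / 2) * |s|) * Real.exp (-δ * |s|)) := by ring
      _ = _ := by rw [← Real.exp_add]; ring_nf

/-! ### Products -/

theorem memLp_two_iff_lintegral_sq {g : ℝ → ℂ} (hg : AEStronglyMeasurable g volume) :
    MemLp g 2 volume ↔ ∫⁻ s, ‖g s‖ₑ ^ 2 < ∞ := by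
  have h := eLpNorm_lt_top_iff_lintegral_rpow_enorm_lt_top (μ := (volume : Measure ℝ)) (f := g)
    (p := 2) (by norm_num) (by norm_num)
  simp only [ENNReal.toReal_ofNat, ENNReal.rpow_ofNat] at h
  exact ⟨fun H => h.1 H.2, fun H => ⟨hg, h.2 H⟩⟩

/-- Young's inequality for the convolution of a function in `L¹` with a function in `L²`. -/
theorem lintegral_sq_conv_le {a b : ℝ → ℝ≥0∞} (ha : Measurable a) (hb : Measurable b) :
    ∫⁻ s, (∫⁻ t, a t * b (s - t)) ^ 2 ≤ (∫⁻ t, a t) ^ 2 * ∫⁻ t, b t ^ 2 := by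
  have h1 : ∀ s, (∫⁻ t, a t * b (s - t)) ^ 2 ≤ (∫⁻ t, a t) * ∫⁻ t, a t * b (s - t) ^ 2 := by
    intro s
    have hbs : Measurable fun t => b (s - t) := hb.comp (by fun_prop)
    -- Cauchy–Schwarz for the splitting `a b = a^{1/2} · (a^{1/2} b)`.
    have h := ENNReal.lintegral_mul_le_Lp_mul_Lq (μ := (volume : Measure ℝ))
      Real.HolderConjugate.two_two
      (f := fun t => a t ^ (1 / 2 : ℝ)) (g := fun t => a t ^ (1 / 2 : ℝ) * b (s - t))
      (by fun_prop) (by fun_prop)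
    have e1 : ∀ t, a t ^ (1 / 2 : ℝ) * (a t ^ (1 / 2 : ℝ) * b (s - t)) = a t * b (s - t) := by
      intro t
      rw [← mul_assoc, ← ENNReal.rpow_add_of_nonneg _ _ (by norm_num) (by norm_num)]
      norm_num
    have e2 : ∀ t, (a t ^ (1 / 2 : ℝ)) ^ (2 : ℝ) = a t := by
      intro t; rw [← ENNReal.rpow_mul]; norm_num
    have e3 : ∀ t, (a t ^ (1 / 2 : ℝ) * b (s - t)) ^ (2 : ℝ) = a t * b (s - t) ^ 2 := by
      intro t; rw [ENNReal.mul_rpow_of_nonneg _ _ (by norm_num), e2]; norm_num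
    simp only [Pi.mul_apply, e1, e2, e3] at h
    calc (∫⁻ t, a t * b (s - t)) ^ 2
        ≤ ((∫⁻ t, a t) ^ (1 / 2 : ℝ) * (∫⁻ t, a t * b (s - t) ^ 2) ^ (1 / 2 : ℝ)) ^ 2 := by
          gcongr
      _ = _ := by
          rw [mul_pow, ← ENNReal.rpow_natCast, ← ENNReal.rpow_natCast, ← ENNReal.rpow_mul,
            ← ENNReal.rpow_mul]
          norm_num
  calc ∫⁻ s, (∫⁻ t, a t * b (s - t)) ^ 2
      ≤ ∫⁻ s, (∫⁻ t, a t) * ∫⁻ t, a t * b (s - t) ^ 2 := lintegral_mono h1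
    _ = (∫⁻ t, a t) * ∫⁻ s, ∫⁻ t, a t * b (s - t) ^ 2 := by
        refine lintegral_const_mul _ (Measurable.lintegral_prod_right ?_)
        fun_prop
    _ = (∫⁻ t, a t) * ∫⁻ t, ∫⁻ s, a t * b (s - t) ^ 2 := by
        rw [lintegral_lintegral_swap]
        fun_prop
    _ = (∫⁻ t, a t) * ∫⁻ t, a t * ∫⁻ s, b s ^ 2 := by
        congr 1
        refine lintegral_congr fun t => ?_
        rw [lintegral_const_mul _ (by fun_prop)]
        congr 1
        exact lintegral_sub_right_eq_self (fun s => b s ^ 2) t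
    _ = _ := by
        rw [lintegral_mul_const _ ha, sq, mul_assoc]

theorem MemWeightedL2.congr {v : ℝ → ℝ} {ω : ℝ} {g h : ℝ → ℂ} (hg : MemWeightedL2 v ω g)
    (e : g =ᵐ[volume] h) : MemWeightedL2 v ω h := by
  refine ⟨hg.1.ae_eq e, hg.2.ae_eq ?_⟩
  filter_upwards [e] with s hs
  rw [weighted_apply, weighted_apply, hs]

theorem fourierStrip_congr (ω : ℝ) {g h : ℝ → ℂ} (e : g =ᵐ[volume] h) :
    fourierStrip ω g = fourierStrip ω h := by
  funext z
  refine integral_congr_ae ?_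
  filter_upwards [e] with s hs
  rw [hs]

theorem exists_measurable_of_mem_sobolevSpace {v : ℝ → ℝ} (hv : StronglyAdmissible v) {ω : ℝ}
    {f : strip ω → ℂ} (hf : f ∈ sobolevSpace hv ω) :
    ∃ g, Measurable g ∧ MemWeightedL2 v ω g ∧ f = fourierStrip ω g := by
  obtain ⟨g, hg, rfl⟩ := hf
  exact ⟨hg.1.1.mk g, hg.1.1.measurable_mk, hg.congr hg.1.1.ae_eq_mk,
    fourierStrip_congr ω hg.1.1.ae_eq_mk⟩

/-- The integrand is `1 / v` times the weighted function, a product of two `L²` functions. This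
supplies the `L¹` factor in Young's inequality. -/
theorem integrable_exp_mul_of_memWeightedL2 {v : ℝ → ℝ} (hv : StronglyAdmissible v) {ω : ℝ}
    {g : ℝ → ℂ} (hg : MemWeightedL2 v ω g) :
    Integrable (fun s => ((Real.exp (ω * |s|) : ℝ) : ℂ) * g s) volume := by
  have h1 : Integrable (fun s => (1 / v s) * ‖weighted v ω g s‖) volume :=
    hv.inv_memLp.integrable_mul hg.2.norm
  refine h1.mono' ?_ (Eventually.of_forall fun s => ?_)
  · exact (by fun_prop : Continuous fun s : ℝ =>
      ((Real.exp (ω * |s|) : ℝ) : ℂ)).aestronglyMeasurable.mul hg.1.1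
  · have hpos : 0 < v s := lt_of_lt_of_le one_pos (hv.one_le s)
    rw [norm_weighted hv, norm_mul, Complex.norm_real, Real.norm_of_nonneg (Real.exp_pos _).le,
      weight]
    apply le_of_eq
    field_simp

/-- The exponential is submultiplicative and `v` is quasi-subadditive, so in each summand only one
factor carries `v`. The other factor carries just the exponential and can be measured in `L¹`. -/
theorem weight_sub_le {v : ℝ → ℝ} (hv : StronglyAdmissible v) {ω : ℝ} (hω : 0 ≤ ω) :
    ∃ M : ℝ, 0 ≤ M ∧ ∀ s t, weight v ω s ≤
      M * (Real.exp (ω * |t|) * weight v ω (s - t) + weight v ω t * Real.exp (ω * |s - t|)) := by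
  obtain ⟨M, hM1, hM⟩ := hv.exists_subadd
  refine ⟨M, by linarith, fun s t => ?_⟩
  have h1 := hM t (s - t)
  rw [add_sub_cancel] at h1
  have h2 : Real.exp (ω * |s|) ≤ Real.exp (ω * |t|) * Real.exp (ω * |s - t|) := by
    rw [← Real.exp_add, Real.exp_le_exp, ← mul_add]
    refine mul_le_mul_of_nonneg_left ?_ hω
    have := abs_add_le t (s - t)
    rwa [add_sub_cancel] at this
  have h3 := hv.one_le t
  have h4 := hv.one_le (s - t)
  calc weight v ω s ≤ (M * (v t + v (s - t))) * (Real.exp (ω * |t|) * Real.exp (ω * |s - t|)) :=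
        mul_le_mul h1 h2 (Real.exp_pos _).le (by nlinarith)
    _ = _ := by unfold weight; ring

/-- By `weight_sub_le` the weighted convolution is dominated by two convolutions of an `L¹` with an
`L²` function, to which Young's inequality applies. -/
theorem memWeightedL2_conv {v : ℝ → ℝ} (hv : StronglyAdmissible v) {ω : ℝ} (hω : 0 ≤ ω)
    {g h : ℝ → ℂ} (hgm : Measurable g) (hhm : Measurable h)
    (hg : MemWeightedL2 v ω g) (hh : MemWeightedL2 v ω h) :
    MemWeightedL2 v ω (fun s => ∫ t, g t * h (s - t)) := by
  obtain ⟨M, hM0, hM⟩ := weight_sub_le hv hω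
  set k : ℝ → ℂ := fun s => ∫ t, g t * h (s - t) with hk
  have hkm : StronglyMeasurable k := by
    refine StronglyMeasurable.integral_prod_right' (f := fun p : ℝ × ℝ => g p.2 * h (p.1 - p.2)) ?_
    exact (by fun_prop : Measurable fun p : ℝ × ℝ => g p.2 * h (p.1 - p.2)).stronglyMeasurable
  have hwm := measurable_weight hv ω
  have hWkm : AEStronglyMeasurable (weighted v ω k) volume :=
    (Complex.measurable_ofReal.comp hwm).aestronglyMeasurable.mul hkm.aestronglyMeasurable
  have hwg : ∀ g : ℝ → ℂ, Measurable g → Measurable (weighted v ω g) := fun g hg =>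
    (Complex.measurable_ofReal.comp hwm).mul hg
  let ex : (ℝ → ℂ) → ℝ → ℂ := fun g s => ((Real.exp (ω * |s|) : ℝ) : ℂ) * g s
  have hex : ∀ g : ℝ → ℂ, Measurable g → Measurable (ex g) := fun g hg =>
    (by fun_prop : Measurable fun s : ℝ => ((Real.exp (ω * |s|) : ℝ) : ℂ)).mul hg
  let A : ℝ → ℝ≥0∞ := fun s => ∫⁻ t, ‖ex g t‖ₑ * ‖weighted v ω h (s - t)‖ₑ
  let B : ℝ → ℝ≥0∞ := fun s => ∫⁻ t, ‖ex h t‖ₑ * ‖weighted v ω g (s - t)‖ₑ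
  have hfin : ∀ g h : ℝ → ℂ, Measurable g → Measurable h → MemWeightedL2 v ω g →
      MemWeightedL2 v ω h →
      ∫⁻ s, (∫⁻ t, ‖ex g t‖ₑ * ‖weighted v ω h (s - t)‖ₑ) ^ 2 < ∞ := by
    intro g h hgm hhm hg hh
    refine (lintegral_sq_conv_le (hex g hgm).enorm (hwg h hhm).enorm).trans_lt ?_
    refine ENNReal.mul_lt_top (ENNReal.pow_lt_top ?_) ?_
    · exact (integrable_exp_mul_of_memWeightedL2 hv hg).2
    · exact (memLp_two_iff_lintegral_sq hh.2.1).1 hh.2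
  have hAm : Measurable A := by
    refine Measurable.lintegral_prod_right ?_
    have := (hex g hgm).enorm
    have := (hwg h hhm).enorm
    fun_prop
  have hBm : Measurable B := by
    refine Measurable.lintegral_prod_right ?_
    have := (hex h hhm).enorm
    have := (hwg g hgm).enorm
    fun_prop
  have hbound : ∀ s, ‖weighted v ω k s‖ₑ ≤ ENNReal.ofReal M * (A s + B s) := by
    intro s
    -- The substitution `t ↦ s - t` lets both dominating integrals be compared pointwise in `t`.
    have e1 : B s = ∫⁻ t, ‖ex h (s - t)‖ₑ * ‖weighted v ω g t‖ₑ := by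
      have := lintegral_sub_left_eq_self (μ := (volume : Measure ℝ))
        (fun t => ‖ex h t‖ₑ * ‖weighted v ω g (s - t)‖ₑ) s
      simp only [sub_sub_cancel] at this
      exact this.symm
    rw [e1, ← lintegral_add_left, ← lintegral_const_mul]
    · rw [weighted_apply, enorm_mul, hk]
      calc ‖(weight v ω s : ℂ)‖ₑ * ‖∫ t, g t * h (s - t)‖ₑ
          ≤ ‖(weight v ω s : ℂ)‖ₑ * ∫⁻ t, ‖g t * h (s - t)‖ₑ := by
            gcongr
            exact enorm_integral_le_lintegral_enorm _
        _ = ∫⁻ t, ‖(weight v ω s : ℂ)‖ₑ * ‖g t * h (s - t)‖ₑ :=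
            (lintegral_const_mul _ (by fun_prop)).symm
        _ ≤ _ := by
            refine lintegral_mono fun t => ?_
            simp only [← ofReal_norm, ← ENNReal.ofReal_mul (norm_nonneg _)]
            rw [← ENNReal.ofReal_add (by positivity) (by positivity),
              ← ENNReal.ofReal_mul hM0]
            apply ENNReal.ofReal_le_ofReal
            simp only [ex, norm_weighted hv, norm_mul, Complex.norm_real,
              Real.norm_of_nonneg (Real.exp_pos _).le, Real.norm_of_nonneg (weight_pos hv ω s).le]
            calc weight v ω s * (‖g t‖ * ‖h (s - t)‖) ≤ _ :=
                  mul_le_mul_of_nonneg_right (hM s t) (by positivity)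
              _ = _ := by ring
    · have := (hex g hgm).enorm
      have := (hwg h hhm).enorm
      have := (hex h hhm).enorm
      have := (hwg g hgm).enorm
      fun_prop
    · have := (hex g hgm).enorm
      have := (hwg h hhm).enorm
      fun_prop
  have hWk : MemLp (weighted v ω k) 2 volume := by
    rw [memLp_two_iff_lintegral_sq hWkm]
    have hsq : ∀ a b : ℝ≥0∞, (a + b) ^ 2 ≤ 2 * (a ^ 2 + b ^ 2) := by
      intro a b
      have := ENNReal.rpow_add_le_mul_rpow_add_rpow a b (by norm_num : (1 : ℝ) ≤ 2)
      norm_num at this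
      exact this
    calc ∫⁻ s, ‖weighted v ω k s‖ₑ ^ 2
        ≤ ∫⁻ s, ENNReal.ofReal M ^ 2 * (2 * (A s ^ 2 + B s ^ 2)) := by
          refine lintegral_mono fun s => ?_
          refine (pow_le_pow_left' (hbound s) 2).trans ?_
          rw [mul_pow]
          gcongr
          exact hsq _ _
      _ = ENNReal.ofReal M ^ 2 * (2 * ((∫⁻ s, A s ^ 2) + ∫⁻ s, B s ^ 2)) := by
          rw [lintegral_const_mul _ (by fun_prop), lintegral_const_mul _ (by fun_prop),
            lintegral_add_left (by fun_prop)]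
      _ < ∞ := by
          refine ENNReal.mul_lt_top (ENNReal.pow_lt_top ENNReal.ofReal_lt_top)
            (ENNReal.mul_lt_top (by norm_num) (ENNReal.add_lt_top.2 ⟨?_, ?_⟩))
          · exact hfin g h hgm hhm hg hh
          · exact hfin h g hhm hgm hh hg
  refine ⟨hWk.mono hkm.aestronglyMeasurable (Eventually.of_forall fun s => ?_), hWk⟩
  rw [norm_weighted hv]
  exact le_mul_of_one_le_left (norm_nonneg _) (one_le_weight hv hω s)

/-- The Sobolev space is closed under pointwise products. -/
theorem mul_mem_sobolevSpace {v : ℝ → ℝ} (hv : StronglyAdmissible v) {ω : ℝ} (hω : 0 ≤ ω)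
    {f₁ f₂ : strip ω → ℂ} (h₁ : f₁ ∈ sobolevSpace hv ω) (h₂ : f₂ ∈ sobolevSpace hv ω) :
    f₁ * f₂ ∈ sobolevSpace hv ω := by
  obtain ⟨g, hgm, hg, rfl⟩ := exists_measurable_of_mem_sobolevSpace hv h₁
  obtain ⟨h, hhm, hh, rfl⟩ := exists_measurable_of_mem_sobolevSpace hv h₂
  refine ⟨_, memWeightedL2_conv hv hω hgm hhm hg hh, ?_⟩
  funext z
  -- For complex `z` the integral formula is applied to the functions already multiplied by
  -- `e^{-isz}`; the exponential then factors out of their convolution.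
  have key := integral_convolution (μ := (volume : Measure ℝ)) (ν := volume)
    (ContinuousLinearMap.mul ℝ ℂ) (integrable_fourierStrip hv hg z) (integrable_fourierStrip hv hh z)
  rw [Pi.mul_apply]
  simp only [fourierStrip]
  rw [ContinuousLinearMap.mul_apply'] at key
  rw [← key]
  refine integral_congr_ae (Eventually.of_forall fun s => ?_)
  simp only [convolution_def, ContinuousLinearMap.mul_apply']
  rw [← integral_const_mul]
  refine integral_congr_ae (Eventually.of_forall fun t => ?_)
  have : Complex.exp (-Complex.I * s * (z : ℂ)) =
      Complex.exp (-Complex.I * t * (z : ℂ)) * Complex.exp (-Complex.I * (s - t : ℝ) * (z : ℂ)) := by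
    rw [← Complex.exp_add]; congr 1; push_cast; ring
  simp only [this]
  ring

/-! ### The Cauchy formula on strips -/

theorem isOpen_openStrip (θ : ℝ) : IsOpen (openStrip θ) :=
  isOpen_lt (by fun_prop) continuous_const

theorem line_mem_openStrip {θ r : ℝ} (hr : |r| < θ) (s : ℝ) :
    (s : ℂ) + (r : ℂ) * Complex.I ∈ openStrip θ := by
  simpa [openStrip] using hr

theorem continuous_line_of_mem_elementary {θ r : ℝ} (hr : |r| < θ) {ψ : ℂ → ℂ}
    (hψ : ψ ∈ elementary θ) : Continuous fun s : ℝ => ψ ((s : ℂ) + (r : ℂ) * Complex.I) :=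
  hψ.1.continuousOn.comp_continuous (by fun_prop) (line_mem_openStrip hr)

theorem integrable_line_of_mem_elementary {θ r : ℝ} (hr : |r| < θ) {ψ : ℂ → ℂ}
    (hψ : ψ ∈ elementary θ) :
    Integrable fun s : ℝ => ψ ((s : ℂ) + (r : ℂ) * Complex.I) := by
  refine ⟨(continuous_line_of_mem_elementary hr hψ).aestronglyMeasurable, ?_⟩
  refine lt_of_le_of_lt ?_ hψ.2.2
  exact le_iSup₂ (f := fun (r : ℝ) (_ : |r| < θ) =>
    ∫⁻ s : ℝ, ‖ψ ((s : ℂ) + (r : ℂ) * Complex.I)‖ₑ) r hr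

/-- A primitive is `½ log(x² + p²) + i arctan(x / p)`; the logarithm is even and cancels over a
symmetric interval. The sign of `p` survives in the arctangent, which produces the residue in
`cauchy_strip`. -/
theorem integral_inv_sub_mul_I {p : ℝ} (hp : p ≠ 0) (R : ℝ) :
    ∫ x in -R..R, ((x : ℂ) - (p : ℂ) * Complex.I)⁻¹ = 2 * Complex.I * Real.arctan (R / p) := by
  have hpos : ∀ x : ℝ, 0 < x ^ 2 + p ^ 2 := fun x => by positivity
  have hne : ∀ x : ℝ, (x : ℂ) - (p : ℂ) * Complex.I ≠ 0 := fun x h => hp (by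
    simpa using congrArg Complex.im h)
  let F : ℝ → ℂ := fun x => ((1 / 2 * Real.log (x ^ 2 + p ^ 2) : ℝ) : ℂ) +
    Complex.I * (Real.arctan (x / p) : ℝ)
  have hF : ∀ x : ℝ, HasDerivAt F (((x : ℂ) - (p : ℂ) * Complex.I)⁻¹) x := by
    intro x
    have h1 : HasDerivAt (fun x : ℝ => 1 / 2 * Real.log (x ^ 2 + p ^ 2))
        (x / (x ^ 2 + p ^ 2)) x := by
      have := ((((hasDerivAt_pow 2 x).add_const (p ^ 2)).log (hpos x).ne').const_mul (1 / 2 : ℝ))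
      refine this.congr_deriv ?_
      push_cast
      ring
    have h2 : HasDerivAt (fun x : ℝ => Real.arctan (x / p)) (p / (x ^ 2 + p ^ 2)) x := by
      have := ((hasDerivAt_id x).div_const p).arctan
      refine this.congr_deriv ?_
      have := hpos x
      have h3 : (1 + (x / p) ^ 2) ≠ 0 := by positivity
      simp only [id]
      field_simp
      ring
    have := (h1.ofReal_comp).add ((h2.ofReal_comp).const_mul Complex.I)
    refine this.congr_deriv ?_
    have e : ((x : ℂ) - (p : ℂ) * Complex.I) * ((x : ℂ) + (p : ℂ) * Complex.I) =
        ((x ^ 2 + p ^ 2 : ℝ) : ℂ) := by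
      push_cast
      linear_combination (-(p : ℂ) ^ 2) * Complex.I_sq
    have e0 : ((x ^ 2 + p ^ 2 : ℝ) : ℂ) ≠ 0 := by exact_mod_cast (hpos x).ne'
    refine eq_inv_of_mul_eq_one_left ?_
    rw [Complex.ofReal_div, Complex.ofReal_div, mul_div_assoc', ← add_div, div_mul_eq_mul_div,
      div_eq_one_iff_eq e0, ← e]
    ring
  rw [intervalIntegral.integral_eq_sub_of_hasDerivAt (fun x _ => hF x)]
  · simp only [F, neg_sq, neg_div, Real.arctan_neg]
    push_cast
    ring
  · refine Continuous.intervalIntegrable ?_ _ _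
    exact Continuous.inv₀ (by fun_prop) hne

theorem norm_inv_sub_le {w z : ℂ} {c : ℝ} (hc : 0 < c) (h : c ≤ |(w - z).im|) :
    ‖(w - z)⁻¹‖ ≤ c⁻¹ := by
  rw [norm_inv]
  exact inv_anti₀ hc (h.trans (Complex.abs_im_le_norm _))

/-- Integrability of the Cauchy kernel against an elementary function. -/
theorem integrable_cauchy_kernel {θ r : ℝ} (hr : |r| < θ) {ψ : ℂ → ℂ}
    (hψ : ψ ∈ elementary θ) {z : ℂ} (hz : z.im ≠ r) :
    Integrable fun s : ℝ => ψ ((s : ℂ) + (r : ℂ) * Complex.I) *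
      ((s : ℂ) + (r : ℂ) * Complex.I - z)⁻¹ := by
  have hpos : 0 < |r - z.im| := abs_pos.2 (sub_ne_zero.2 hz.symm)
  have him : ∀ s : ℝ, ((s : ℂ) + (r : ℂ) * Complex.I - z).im = r - z.im := fun s => by simp
  refine (integrable_line_of_mem_elementary hr hψ).mul_bdd (c := |r - z.im|⁻¹) ?_ ?_
  · refine (Continuous.inv₀ (by fun_prop) fun s h => ?_).aestronglyMeasurable
    have := him s
    rw [h] at this
    exact hz (by simpa [sub_eq_zero, eq_comm] using this)
  · exact Eventually.of_forall fun s => norm_inv_sub_le hpos (by rw [him])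

/-- Cauchy's formula on a strip. -/
theorem cauchy_strip {θ δ : ℝ} (hδ : δ < θ) {ψ : ℂ → ℂ} (hψ : ψ ∈ elementary θ) {z : ℂ}
    (hz : |z.im| < δ) :
    (∫ s : ℝ, ψ ((s : ℂ) + ((-δ : ℝ) : ℂ) * Complex.I) *
        ((s : ℂ) + ((-δ : ℝ) : ℂ) * Complex.I - z)⁻¹) -
      ∫ s : ℝ, ψ ((s : ℂ) + (δ : ℂ) * Complex.I) * ((s : ℂ) + (δ : ℂ) * Complex.I - z)⁻¹ =
    2 * Real.pi * Complex.I * ψ z := by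
  have hδ0 : 0 < δ := (abs_nonneg _).trans_lt hz
  obtain ⟨hz1, hz2⟩ := abs_lt.1 hz
  have habs : |(-δ)| < θ := by rwa [abs_neg, abs_of_pos hδ0]
  have habs' : |δ| < θ := by rwa [abs_of_pos hδ0]
  obtain ⟨C, hC⟩ := hψ.2.1
  set a := z.re with ha
  have hzmem : openStrip θ ∈ 𝓝 z := (isOpen_openStrip θ).mem_nhds (hz.trans hδ)
  -- The difference quotient has a removable singularity at `z`, so Cauchy's theorem for rectangles
  -- suffices and no residue theorem is needed.
  have hd : DifferentiableOn ℂ (dslope ψ z) (openStrip θ) :=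
    (Complex.differentiableOn_dslope hzmem).2 hψ.1
  have hds : ∀ w : ℂ, w ≠ z → dslope ψ z w = ψ w * (w - z)⁻¹ - ψ z * (w - z)⁻¹ := by
    intro w hw
    rw [dslope_of_ne _ hw, slope_def_field, div_eq_mul_inv, sub_mul]
  -- the boundary of the rectangle with vertical sides at distance `R` from `z`
  have hrect := fun R : ℝ => Complex.integral_boundary_rect_eq_zero_of_differentiableOn (dslope ψ z)
    (⟨a - R, -δ⟩ : ℂ) (⟨a + R, δ⟩ : ℂ) (hd.mono (by
      intro w hw
      have h1 := hw.2
      rw [Set.mem_preimage, Set.uIcc_of_le (by linarith : -δ ≤ δ)] at h1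
      exact (abs_le.2 h1).trans_lt hδ))
  simp only at hrect
  -- The part `ψ z / (w - z)` is not absolutely integrable along a line, so it is integrated
  -- explicitly over an interval centred at `Re z`.
  have hline : ∀ r : ℝ, |r| < θ → z.im ≠ r → ∀ R : ℝ,
      ∫ x in (a - R)..(a + R), dslope ψ z ((x : ℂ) + (r : ℂ) * Complex.I) =
      (∫ x in (a - R)..(a + R), ψ ((x : ℂ) + (r : ℂ) * Complex.I) *
        ((x : ℂ) + (r : ℂ) * Complex.I - z)⁻¹) -
        ψ z * (2 * Complex.I * Real.arctan (R / (z.im - r))) := by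
    intro r hr hzr R
    have hne : ∀ x : ℝ, (x : ℂ) + (r : ℂ) * Complex.I ≠ z := fun x h => hzr (by
      simpa using (congrArg Complex.im h).symm)
    have hcont : Continuous fun x : ℝ => ((x : ℂ) + (r : ℂ) * Complex.I - z)⁻¹ :=
      Continuous.inv₀ (by fun_prop) fun x => sub_ne_zero.2 (hne x)
    simp only [hds _ (hne _)]
    rw [intervalIntegral.integral_sub, intervalIntegral.integral_const_mul,
      ← integral_inv_sub_mul_I (sub_ne_zero.2 hzr) R]
    · have := intervalIntegral.integral_comp_add_right (a := -R) (b := R)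
        (fun x : ℝ => ((x : ℂ) + (r : ℂ) * Complex.I - z)⁻¹) a
      rw [show -R + a = a - R by ring, show R + a = a + R by ring] at this
      rw [← this]
      congr 2
      refine intervalIntegral.integral_congr fun x _ => ?_
      congr 1
      apply Complex.ext <;> simp [ha]
    · exact (integrable_cauchy_kernel hr hψ hzr).intervalIntegrable
    · exact (continuous_const.mul hcont).intervalIntegrable _ _
  have hlim : ∀ r : ℝ, |r| < θ → z.im ≠ r → Tendsto (fun R : ℝ =>
      ∫ x in (a - R)..(a + R), ψ ((x : ℂ) + (r : ℂ) * Complex.I) *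
        ((x : ℂ) + (r : ℂ) * Complex.I - z)⁻¹) atTop
      (𝓝 (∫ x : ℝ, ψ ((x : ℂ) + (r : ℂ) * Complex.I) *
        ((x : ℂ) + (r : ℂ) * Complex.I - z)⁻¹)) := fun r hr hzr =>
    intervalIntegral_tendsto_integral (integrable_cauchy_kernel hr hψ hzr)
      (tendsto_atBot_add_const_left _ a tendsto_neg_atTop_atBot)
      (tendsto_atTop_add_const_left _ a tendsto_id)
  -- On the vertical sides the difference quotient is at most `2C / R`; `σ = ±1` selects the side.
  have hvert : ∀ σ : ℝ, |σ| = 1 → Tendsto (fun R : ℝ =>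
      ∫ y in (-δ)..δ, dslope ψ z (((a + σ * R : ℝ) : ℂ) + (y : ℂ) * Complex.I)) atTop (𝓝 0) := by
    intro σ hσ
    have hlim0 : Tendsto (fun R : ℝ => ((C + C) * R⁻¹) * |δ - -δ|) atTop (𝓝 0) := by
      have := ((tendsto_inv_atTop_zero (𝕜 := ℝ)).const_mul (C + C)).mul_const |δ - -δ|
      simpa using this
    refine squeeze_zero_norm' ?_ hlim0
    filter_upwards [eventually_gt_atTop 0] with R hR
    refine intervalIntegral.norm_integral_le_of_norm_le_const fun y hy => ?_
    rw [Set.uIoc_of_le (by linarith)] at hy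
    set w : ℂ := ((a + σ * R : ℝ) : ℂ) + (y : ℂ) * Complex.I with hw
    have hre : (w - z).re = σ * R := by simp [hw, ha]
    have hRw : R ≤ ‖w - z‖ := by
      have := Complex.abs_re_le_norm (w - z)
      rwa [hre, abs_mul, hσ, one_mul, abs_of_pos hR] at this
    have hwz : w ≠ z := by
      rintro h
      rw [h, sub_self, norm_zero] at hRw
      linarith
    rw [dslope_of_ne _ hwz, slope_def_field, norm_div, div_eq_mul_inv]
    have hwm : w ∈ openStrip θ := line_mem_openStrip
      ((abs_le.2 ⟨hy.1.le, hy.2⟩).trans_lt hδ) _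
    have h1 : ‖ψ w - ψ z‖ ≤ C + C :=
      (norm_sub_le _ _).trans (add_le_add (hC _ hwm) (hC _ (hz.trans hδ)))
    exact mul_le_mul h1 (inv_anti₀ hR hRw) (by positivity) ((norm_nonneg _).trans h1)
  have harc1 : Tendsto (fun R : ℝ => (Real.arctan (R / (z.im - -δ)) : ℂ)) atTop
      (𝓝 ((Real.pi / 2 : ℝ) : ℂ)) := by
    refine (Complex.continuous_ofReal.tendsto _).comp
      (tendsto_nhds_of_tendsto_nhdsWithin (Real.tendsto_arctan_atTop.comp ?_))
    exact tendsto_id.atTop_div_const (by linarith)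
  have harc2 : Tendsto (fun R : ℝ => (Real.arctan (R / (z.im - δ)) : ℂ)) atTop
      (𝓝 ((-(Real.pi / 2) : ℝ) : ℂ)) := by
    refine (Complex.continuous_ofReal.tendsto _).comp
      (tendsto_nhds_of_tendsto_nhdsWithin (Real.tendsto_arctan_atBot.comp ?_))
    exact tendsto_id.atTop_div_const_of_neg (by linarith)
  have hz1' : z.im ≠ -δ := hz1.ne'
  -- As `z` lies between the lines, the two arctangents tend to `π/2` and `-π/2`; together they
  -- contribute `2πi ψ z`.
  have htot := ((((hlim (-δ) habs hz1').sub ((harc1.const_mul (2 * Complex.I)).const_mul (ψ z))).sub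
    ((hlim δ habs' hz2.ne).sub ((harc2.const_mul (2 * Complex.I)).const_mul (ψ z)))).add
    ((hvert 1 (by simp)).const_smul Complex.I)).sub ((hvert (-1) (by simp)).const_smul Complex.I)
  have hzero : Tendsto (fun _ : ℝ => (0 : ℂ)) atTop (𝓝 0) := tendsto_const_nhds
  have huniq := tendsto_nhds_unique (htot.congr fun R => by
    rw [← hline (-δ) habs hz1', ← hline δ habs' hz2.ne, one_mul, neg_one_mul, ← sub_eq_add_neg]
    exact hrect R) hzero
  rw [smul_zero, add_zero, sub_zero, sub_eq_zero] at huniq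
  rw [← sub_eq_zero]
  push_cast at huniq ⊢
  linear_combination huniq

/-! ### The Sobolev space as a quotient of `L²(ℝ)` -/

/-- The inverse of the multiplication by the weight. -/
def unweighted (v : ℝ → ℝ) (ω : ℝ) (h : ℝ → ℂ) : ℝ → ℂ :=
  fun s => ((weight v ω s)⁻¹ : ℂ) * h s

theorem weighted_unweighted {v : ℝ → ℝ} (hv : StronglyAdmissible v) (ω : ℝ) (h : ℝ → ℂ) :
    weighted v ω (unweighted v ω h) = h := by
  funext s
  have : (weight v ω s : ℂ) ≠ 0 := by exact_mod_cast (weight_pos hv ω s).ne'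
  rw [weighted_apply, unweighted, mul_inv_cancel_left₀ this]

theorem unweighted_weighted {v : ℝ → ℝ} (hv : StronglyAdmissible v) (ω : ℝ) (g : ℝ → ℂ) :
    unweighted v ω (weighted v ω g) = g := by
  funext s
  have : (weight v ω s : ℂ) ≠ 0 := by exact_mod_cast (weight_pos hv ω s).ne'
  rw [unweighted, weighted_apply, inv_mul_cancel_left₀ this]

theorem memWeightedL2_unweighted {v : ℝ → ℝ} (hv : StronglyAdmissible v) {ω : ℝ} (hω : 0 ≤ ω)
    {h : ℝ → ℂ} (hh : MemLp h 2 volume) : MemWeightedL2 v ω (unweighted v ω h) := by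
  have hw := measurable_weight hv ω
  refine ⟨hh.mono ?_ (Eventually.of_forall fun s => ?_), by rwa [weighted_unweighted hv]⟩
  · exact (by fun_prop : Measurable fun s => ((weight v ω s)⁻¹ : ℂ)).aestronglyMeasurable.mul hh.1
  · have h1 := one_le_weight hv hω s
    rw [unweighted, norm_mul, norm_inv, Complex.norm_real,
      Real.norm_of_nonneg (weight_pos hv ω s).le]
    exact mul_le_of_le_one_left (norm_nonneg _) (inv_le_one_of_one_le₀ h1)

/-- The map which sends `h ∈ L²(ℝ)` to the transform of `h / (v e^{ω|·|})`. -/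
def sobolevOfL2 {v : ℝ → ℝ} (hv : StronglyAdmissible v) {ω : ℝ} (hω : 0 ≤ ω) :
    Lp ℂ 2 (volume : Measure ℝ) →ₗ[ℂ] sobolevSpace hv ω where
  toFun h := ⟨fourierStrip ω (unweighted v ω h), _, memWeightedL2_unweighted hv hω (Lp.memLp h), rfl⟩
  map_add' h k := by
    apply Subtype.ext
    have e : unweighted v ω (h + k : Lp ℂ 2 volume) =ᵐ[volume]
        unweighted v ω h + unweighted v ω k := by
      filter_upwards [Lp.coeFn_add h k] with s hs
      simp only [unweighted, hs, Pi.add_apply, mul_add]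
    funext z
    simp only [fourierStrip_congr ω e, Submodule.coe_add, Pi.add_apply]
    simp only [fourierStrip, Pi.add_apply, mul_add]
    exact integral_add
      (integrable_fourierStrip hv (memWeightedL2_unweighted hv hω (Lp.memLp h)) z)
      (integrable_fourierStrip hv (memWeightedL2_unweighted hv hω (Lp.memLp k)) z)
  map_smul' c h := by
    apply Subtype.ext
    have e : unweighted v ω (c • h : Lp ℂ 2 volume) =ᵐ[volume] c • unweighted v ω h := by
      filter_upwards [Lp.coeFn_smul c h] with s hs
      simp only [unweighted, hs, Pi.smul_apply, smul_eq_mul, mul_left_comm]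
    funext z
    simp only [fourierStrip_congr ω e, Submodule.coe_smul, Pi.smul_apply, RingHom.id_apply]
    simp only [fourierStrip, Pi.smul_apply, smul_eq_mul, mul_left_comm _ c]
    exact integral_const_mul c _

theorem sobolevOfL2_toLp {v : ℝ → ℝ} (hv : StronglyAdmissible v) {ω : ℝ} (hω : 0 ≤ ω)
    {g : ℝ → ℂ} (hg : MemWeightedL2 v ω g) :
    (sobolevOfL2 hv hω (hg.2.toLp _) : strip ω → ℂ) = fourierStrip ω g := by
  refine fourierStrip_congr ω ?_
  filter_upwards [hg.2.coeFn_toLp] with s hs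
  rw [unweighted, hs]
  exact congrFun (unweighted_weighted hv ω g) s

theorem exists_sobolevOfL2_eq {v : ℝ → ℝ} (hv : StronglyAdmissible v) {ω : ℝ} (hω : 0 ≤ ω)
    (f : sobolevSpace hv ω) : ∃ h, sobolevOfL2 hv hω h = f := by
  obtain ⟨g, hg, e⟩ := f.2
  exact ⟨hg.2.toLp _, Subtype.ext (by rw [sobolevOfL2_toLp hv hω hg, e])⟩

/-- The Sobolev norm is an infimum over representatives, so this bound does not require injectivity
of the transform. -/
theorem sobolevNorm_sobolevOfL2_le {v : ℝ → ℝ} (hv : StronglyAdmissible v) {ω : ℝ} (hω : 0 ≤ ω)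
    (h : Lp ℂ 2 (volume : Measure ℝ)) : sobolevNorm v ω (sobolevOfL2 hv hω h) ≤ ‖h‖ₑ := by
  refine (iInf₂_le (unweighted v ω h)
    ⟨memWeightedL2_unweighted hv hω (Lp.memLp h), rfl⟩).trans ?_
  rw [weighted_unweighted hv, Lp.enorm_def]

/-- Functions with finite Sobolev norm belong to the Sobolev space. -/
theorem mem_sobolevSpace_of_sobolevNorm_lt_top {v : ℝ → ℝ} (hv : StronglyAdmissible v) {ω : ℝ}
    {f : strip ω → ℂ} (hf : sobolevNorm v ω f < ∞) : f ∈ sobolevSpace hv ω := by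
  simp only [sobolevNorm, iInf_lt_iff] at hf
  obtain ⟨g, hg, -⟩ := hf
  exact ⟨g, hg⟩

/-- Evaluation of the elements of the Sobolev space is continuous. -/
theorem exists_eval_clm {v : ℝ → ℝ} (hv : StronglyAdmissible v) {ω : ℝ} (hω : 0 ≤ ω)
    (z : strip ω) : ∃ ev : Lp ℂ 2 (volume : Measure ℝ) →L[ℂ] ℂ,
      ∀ h, ev h = (sobolevOfL2 hv hω h : strip ω → ℂ) z := by
  -- Evaluation is the inner product with this kernel, conjugated because the inner product is
  -- conjugate-linear on the left. On the strip `|e^{-isz}| ≤ e^{ω|s|}`, so the kernel is bounded by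
  -- `1 / v`.
  let k : ℝ → ℂ := fun s =>
    starRingEnd ℂ (Complex.exp (-Complex.I * s * (z : ℂ)) * ((weight v ω s)⁻¹ : ℂ))
  have hw := measurable_weight hv ω
  have hk : MemLp k 2 volume := by
    refine hv.inv_memLp.mono (Measurable.aestronglyMeasurable ?_) (Eventually.of_forall fun s => ?_)
    · exact Complex.continuous_conj.measurable.comp (by fun_prop)
    · have hpos : 0 < v s := lt_of_lt_of_le one_pos (hv.one_le s)
      have hz := abs_im_le_of_mem_strip z.2
      have e2 : s * (z : ℂ).im ≤ ω * |s| := by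
        calc s * (z : ℂ).im ≤ |s * (z : ℂ).im| := le_abs_self _
          _ = |(z : ℂ).im| * |s| := by rw [abs_mul, mul_comm]
          _ ≤ ω * |s| := mul_le_mul_of_nonneg_right hz (abs_nonneg _)
      rw [Real.norm_of_nonneg (by positivity), RCLike.norm_conj, norm_mul, Complex.norm_exp,
        norm_inv, Complex.norm_real, Real.norm_of_nonneg (weight_pos hv ω s).le, weight, mul_inv,
        ← Real.exp_neg]
      have e3 : (-Complex.I * s * (z : ℂ)).re = s * (z : ℂ).im := by simp
      rw [e3, mul_left_comm, ← Real.exp_add, one_div]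
      refine mul_le_of_le_one_right (by positivity) (Real.exp_le_one_iff.2 (by linarith))
  refine ⟨innerSL ℂ (hk.toLp k), fun h => ?_⟩
  rw [innerSL_apply_apply, L2.inner_def]
  refine integral_congr_ae ?_
  filter_upwards [hk.coeFn_toLp] with s hs
  rw [hs]
  simp only [k, RCLike.inner_apply, RCLike.conj_conj, unweighted]
  ring

/-! ### Resolvent functions -/

/-- The function with transform `(l - z)⁻¹`. -/
def resKernel (l : ℂ) (s : ℝ) : ℂ :=
  if 0 < l.im then (Set.Ioi 0).indicator (fun s : ℝ => -Complex.I * Complex.exp (Complex.I * l * s)) s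
  else (Set.Iic 0).indicator (fun s : ℝ => Complex.I * Complex.exp (Complex.I * l * s)) s

theorem measurable_resKernel (l : ℂ) : Measurable (resKernel l) := by
  unfold resKernel
  split_ifs
  · exact Measurable.indicator (by fun_prop) measurableSet_Ioi
  · exact Measurable.indicator (by fun_prop) measurableSet_Iic

/-- A horizontal shift of the resolvent point is a modulation of the kernel. Norm bounds and
continuity along a horizontal line follow from this. -/
theorem resKernel_add_mul_I (x r s : ℝ) : resKernel (x + r * Complex.I) s =
    Complex.exp (Complex.I * x * s) * resKernel (r * Complex.I) s := by
  simp only [resKernel, Complex.add_im, Complex.ofReal_im, zero_add]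
  have : ∀ t : ℝ, Complex.exp (Complex.I * (x + r * Complex.I) * t) =
      Complex.exp (Complex.I * x * t) * Complex.exp (Complex.I * (r * Complex.I) * t) := fun t => by
    rw [← Complex.exp_add]; ring_nf
  split_ifs <;> simp only [Set.indicator_apply, this] <;> split_ifs <;> ring

theorem norm_resKernel_le (l : ℂ) (s : ℝ) : ‖resKernel l s‖ ≤ 1 * Real.exp (-|l.im| * |s|) := by
  have e : ‖Complex.exp (Complex.I * l * s)‖ = Real.exp (-(l.im * s)) := by
    rw [Complex.norm_exp]; simp
  rw [one_mul]
  unfold resKernel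
  split_ifs with h
  · rw [Set.indicator_apply]
    split_ifs with hs
    · rw [norm_mul, norm_neg, Complex.norm_I, one_mul, e, abs_of_pos h, abs_of_pos hs, neg_mul]
    · rw [norm_zero]; positivity
  · rw [Set.indicator_apply]
    split_ifs with hs
    · rw [norm_mul, Complex.norm_I, one_mul, e, abs_of_nonpos (not_lt.1 h), abs_of_nonpos hs]
      ring_nf; rfl
    · rw [norm_zero]; positivity

theorem memWeightedL2_resKernel {v : ℝ → ℝ} (hv : StronglyAdmissible v) {ω : ℝ} (hω : 0 ≤ ω)
    {l : ℂ} (hl : ω < |l.im|) : MemWeightedL2 v ω (resKernel l) :=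
  memWeightedL2_of_norm_le_exp hv hω (measurable_resKernel l).aestronglyMeasurable hl
    (norm_resKernel_le l)

theorem fourierStrip_resKernel {ω : ℝ} {l : ℂ} (hl : ω < |l.im|) :
    fourierStrip ω (resKernel l) = fun z : strip ω => (l - (z : ℂ))⁻¹ := by
  funext z
  have hz := abs_im_le_of_mem_strip z.2
  obtain ⟨hz1, hz2⟩ := abs_le.1 hz
  have hre : (Complex.I * (l - z)).re = (z : ℂ).im - l.im := by simp
  have e : ∀ s : ℝ, Complex.exp (-Complex.I * s * (z : ℂ)) * Complex.exp (Complex.I * l * s) =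
      Complex.exp (Complex.I * (l - z) * s) := fun s => by
    rw [← Complex.exp_add]; ring_nf
  simp only [fourierStrip]
  rcases lt_or_ge 0 l.im with h | h
  · rw [abs_of_pos h] at hl
    have hneg : (Complex.I * (l - z)).re < 0 := by rw [hre]; linarith
    have hne : l - (z : ℂ) ≠ 0 := fun h0 => by simp [h0] at hneg
    have e1 : ∀ s : ℝ, Complex.exp (-Complex.I * s * (z : ℂ)) * resKernel l s =
        (Set.Ioi 0).indicator (fun s : ℝ => -Complex.I * Complex.exp (Complex.I * (l - z) * s)) s := by
      intro s
      rw [resKernel, if_pos h, Set.indicator_apply, Set.indicator_apply]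
      split_ifs
      · rw [← e]; ring
      · rw [mul_zero]
    simp only [e1]
    rw [integral_indicator measurableSet_Ioi, integral_const_mul,
      integral_exp_mul_complex_Ioi hneg]
    simp only [Complex.ofReal_zero, mul_zero, Complex.exp_zero]
    field_simp [Complex.I_ne_zero]
  · rw [abs_of_nonpos h] at hl
    have hpos : 0 < (Complex.I * (l - z)).re := by rw [hre]; linarith
    have hne : l - (z : ℂ) ≠ 0 := fun h0 => by simp [h0] at hpos
    have e1 : ∀ s : ℝ, Complex.exp (-Complex.I * s * (z : ℂ)) * resKernel l s =
        (Set.Iic 0).indicator (fun s : ℝ => Complex.I * Complex.exp (Complex.I * (l - z) * s)) s := by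
      intro s
      rw [resKernel, if_neg (not_lt.2 h), Set.indicator_apply, Set.indicator_apply]
      split_ifs
      · rw [← e]; ring
      · rw [mul_zero]
    simp only [e1]
    rw [integral_indicator measurableSet_Iic, integral_const_mul,
      integral_exp_mul_complex_Iic hpos]
    simp only [Complex.ofReal_zero, mul_zero, Complex.exp_zero]
    field_simp [Complex.I_ne_zero]

/-- The function `(l - z)⁻¹`, as an element of the Sobolev space. -/
def resFun {v : ℝ → ℝ} (hv : StronglyAdmissible v) {ω : ℝ} (hω : 0 ≤ ω) {l : ℂ}
    (hl : ω < |l.im|) : sobolevSpace hv ω :=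
  ⟨fun z => (l - (z : ℂ))⁻¹, _, memWeightedL2_resKernel hv hω hl, (fourierStrip_resKernel hl).symm⟩

/-- The `L²`-function which represents `(l - z)⁻¹`. -/
def resL2 {v : ℝ → ℝ} (hv : StronglyAdmissible v) {ω : ℝ} (hω : 0 ≤ ω) {l : ℂ}
    (hl : ω < |l.im|) : Lp ℂ 2 (volume : Measure ℝ) :=
  (memWeightedL2_resKernel hv hω hl).2.toLp _

theorem sobolevOfL2_resL2 {v : ℝ → ℝ} (hv : StronglyAdmissible v) {ω : ℝ} (hω : 0 ≤ ω) {l : ℂ}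
    (hl : ω < |l.im|) : sobolevOfL2 hv hω (resL2 hv hω hl) = resFun hv hω hl :=
  Subtype.ext ((sobolevOfL2_toLp hv hω (memWeightedL2_resKernel hv hω hl)).trans (fourierStrip_resKernel hl))

theorem abs_im_line {ω r : ℝ} (hr : ω < |r|) (x : ℝ) :
    ω < |((x : ℂ) + (r : ℂ) * Complex.I).im| := by simpa using hr

theorem norm_resL2_line_le {v : ℝ → ℝ} (hv : StronglyAdmissible v) {ω : ℝ} (hω : 0 ≤ ω) {r : ℝ}
    (hr : ω < |r|) : ∃ C : ℝ, ∀ x : ℝ, ‖resL2 hv hω (abs_im_line hr x)‖ ≤ C := by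
  refine ⟨‖resL2 hv hω (abs_im_line hr 0)‖, fun x => ?_⟩
  refine Lp.norm_le_norm_of_ae_le ?_
  filter_upwards [(memWeightedL2_resKernel hv hω (abs_im_line hr x)).2.coeFn_toLp,
    (memWeightedL2_resKernel hv hω (abs_im_line hr 0)).2.coeFn_toLp] with s h1 h2
  rw [resL2, resL2, h1, h2, norm_weighted hv, norm_weighted hv, resKernel_add_mul_I,
    resKernel_add_mul_I, norm_mul, norm_mul]
  apply le_of_eq
  congr 2
  simp [Complex.norm_exp]

/-- Since `|e^{ixs} - e^{iys}| ≤ |x - y| |s|`, the map is Lipschitz, with constant the weighted norm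
of `s` times the kernel at `ir`. Half of the gap `|r| - ω` absorbs the factor `|s|`. -/
theorem continuous_resL2_line {v : ℝ → ℝ} (hv : StronglyAdmissible v) {ω : ℝ} (hω : 0 ≤ ω) {r : ℝ}
    (hr : ω < |r|) : Continuous fun x : ℝ => resL2 hv hω (abs_im_line hr x) := by
  set ε := (|r| - ω) / 2 with hε
  have hε0 : 0 < ε := by rw [hε]; linarith
  have hq : MemWeightedL2 v ω (fun s => (s : ℂ) * resKernel (r * Complex.I) s) := by
    refine memWeightedL2_of_norm_le_exp hv hω (C := ε⁻¹) (δ := ω + ε) ?_ (by linarith) fun s => ?_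
    · exact (Complex.measurable_ofReal.mul (measurable_resKernel _)).aestronglyMeasurable
    · have h1 := norm_resKernel_le (r * Complex.I) s
      have e1 : ((r : ℂ) * Complex.I).im = r := by simp
      rw [one_mul, e1] at h1
      have h2 : |s| ≤ ε⁻¹ * Real.exp (ε * |s|) := by
        have := Real.add_one_le_exp (ε * |s|)
        rw [le_inv_mul_iff₀ hε0]
        linarith
      rw [norm_mul, Complex.norm_real, Real.norm_eq_abs]
      calc |s| * ‖resKernel (r * Complex.I) s‖
          ≤ (ε⁻¹ * Real.exp (ε * |s|)) * Real.exp (-|r| * |s|) :=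
            mul_le_mul h2 h1 (norm_nonneg _) (by positivity)
        _ = _ := by
          rw [mul_assoc, ← Real.exp_add]
          congr 2
          rw [hε]; ring
  refine LipschitzWith.continuous (K := ‖hq.2.toLp _‖₊) (LipschitzWith.of_dist_le_mul fun x y => ?_)
  rw [dist_eq_norm]
  refine (Lp.norm_le_mul_norm_of_ae_le_mul (c := dist x y) ?_).trans_eq (mul_comm _ _)
  filter_upwards [(memWeightedL2_resKernel hv hω (abs_im_line hr x)).2.coeFn_toLp,
    (memWeightedL2_resKernel hv hω (abs_im_line hr y)).2.coeFn_toLp, hq.2.coeFn_toLp,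
    Lp.coeFn_sub (resL2 hv hω (abs_im_line hr x)) (resL2 hv hω (abs_im_line hr y))]
    with s h1 h2 h3 h4
  rw [h4, Pi.sub_apply, resL2, resL2, h1, h2, h3, norm_weighted hv, weighted_apply, weighted_apply,
    ← mul_sub, norm_mul, Complex.norm_real, Real.norm_of_nonneg (weight_pos hv ω s).le,
    resKernel_add_mul_I, resKernel_add_mul_I, ← sub_mul, norm_mul, norm_mul]
  rw [mul_left_comm (dist x y)]
  refine mul_le_mul_of_nonneg_left ?_ (weight_pos hv ω s).le
  rw [← mul_assoc]
  refine mul_le_mul_of_nonneg_right ?_ (norm_nonneg _)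
  have e2 : Complex.exp (Complex.I * x * s) - Complex.exp (Complex.I * y * s) =
      Complex.exp (Complex.I * y * s) * (Complex.exp (Complex.I * ((x - y) * s : ℝ)) - 1) := by
    rw [mul_sub, ← Complex.exp_add, mul_one]
    push_cast
    ring_nf
  have e3 : ‖Complex.exp (Complex.I * y * s)‖ = 1 := by simp [Complex.norm_exp]
  rw [e2, norm_mul, e3, one_mul, Complex.norm_real, Real.dist_eq, Real.norm_eq_abs, ← abs_mul]
  exact Real.norm_exp_I_mul_ofReal_sub_one_le

variable {X : Type*} [NormedAddCommGroup X] [NormedSpace ℂ X]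

/-! ### Bounded Sobolev calculi and the elementary calculus -/

theorem IsResolventAt.unique {A : X →ₗ.[ℂ] X} {l : ℂ} {R R' : X →L[ℂ] X}
    (h : IsResolventAt A l R) (h' : IsResolventAt A l R') : R = R' := by
  ext x
  obtain ⟨hx, e⟩ := h.1 x
  have := h'.2 ⟨R x, hx⟩
  rw [e] at this
  exact this.symm

theorem IsResolventAt.resolventOp_eq {A : X →ₗ.[ℂ] X} {l : ℂ} {R : X →L[ℂ] X}
    (h : IsResolventAt A l R) : resolventOp A l = R := by
  have hex : ∃ R, IsResolventAt A l R := ⟨R, h⟩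
  rw [resolventOp, dif_pos hex]
  exact hex.choose_spec.unique h

/-- The resolvent equation determines resolvents. -/
theorem IsResolventAt.of_resolvent_eq {A : X →ₗ.[ℂ] X} {l m : ℂ} {R S : X →L[ℂ] X}
    (h : IsResolventAt A l R) (h1 : S - R = (l - m) • (S * R)) (h2 : S - R = (l - m) • (R * S)) :
    IsResolventAt A m S := by
  constructor
  · intro x
    -- Writing `S x` as a value of `R` shows that it lies in the domain of `A`.
    have e : R (x + (l - m) • S x) = S x := by
      have := congrArg (fun T : X →L[ℂ] X => T x) h2
      simp only [sub_apply, smul_apply,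
        mul_apply_eq_comp] at this
      rw [map_add, map_smul, ← this, add_sub_cancel]
    obtain ⟨hx, hy⟩ := h.1 (x + (l - m) • S x)
    have hx' : S x ∈ A.domain := e ▸ hx
    have hA : A ⟨S x, hx'⟩ = A ⟨R (x + (l - m) • S x), hx⟩ := by
      congr 1
      exact Subtype.ext e.symm
    refine ⟨hx', ?_⟩
    have : A ⟨R (x + (l - m) • S x), hx⟩ = l • S x - (x + (l - m) • S x) := by
      have h3 : l • S x = l • R (x + (l - m) • S x) := by rw [e]
      rw [eq_sub_iff_add_eq]
      exact (h3.trans (sub_eq_iff_eq_add'.1 hy)).symm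
    rw [hA, this, sub_smul]
    abel
  · intro x
    have hu := h.2 x
    have := congrArg (fun T : X →L[ℂ] X => T (l • (x : X) - A x)) h1
    simp only [sub_apply, smul_apply,
      mul_apply_eq_comp, hu] at this
    have e : m • (x : X) - A x = (l • (x : X) - A x) - (l - m) • (x : X) := by
      rw [sub_smul]; abel
    rw [e, map_sub, map_smul, sub_eq_iff_eq_add.1 this]
    abel

/-- `Ψ` is a bounded `W²_v(St_ω)`-calculus for `A`. -/
structure IsBoundedCalculus {v : ℝ → ℝ} (hv : StronglyAdmissible v) (ω : ℝ) (A : X →ₗ.[ℂ] X)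
    (Ψ : sobolevSpace hv ω →ₗ[ℂ] (X →L[ℂ] X)) : Prop where
  map_mul : ∀ f g h : sobolevSpace hv ω,
    (h : strip ω → ℂ) = (f : strip ω → ℂ) * (g : strip ω → ℂ) → Ψ h = Ψ f * Ψ g
  bound : ∃ C : ℝ≥0, ∀ f : sobolevSpace hv ω, ‖Ψ f‖ₑ ≤ C * sobolevNorm v ω f
  resolvent : ∃ l : ℂ, ω < |l.im| ∧ ∃ r : sobolevSpace hv ω,
    (r : strip ω → ℂ) = (fun z : strip ω => (l - (z : ℂ))⁻¹) ∧ IsResolventAt A l (Ψ r)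

namespace IsBoundedCalculus

variable {v : ℝ → ℝ} {hv : StronglyAdmissible v} {ω : ℝ} {A : X →ₗ.[ℂ] X}
  {Ψ : sobolevSpace hv ω →ₗ[ℂ] (X →L[ℂ] X)}

/-- The functions `(m - z)⁻¹` satisfy the resolvent identity and `Ψ` is multiplicative, so one known
resolvent yields all others, including those on the opposite side of the strip. -/
theorem isResolventAt (hΨ : IsBoundedCalculus hv ω A Ψ) (hω : 0 ≤ ω) {m : ℂ} (hm : ω < |m.im|) :
    IsResolventAt A m (Ψ (resFun hv hω hm)) := by
  obtain ⟨l, hl, r, hr, hR⟩ := hΨ.resolvent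
  have hr' : r = resFun hv hω hl := Subtype.ext hr
  subst hr'
  set S := resFun hv hω hm with hS
  set R := resFun hv hω hl with hRdef
  have hne : ∀ (n : ℂ), ω < |n.im| → ∀ z : strip ω, n - (z : ℂ) ≠ 0 := by
    intro n hn z h0
    have := abs_im_le_of_mem_strip z.2
    rw [sub_eq_zero] at h0
    rw [h0] at hn
    linarith
  let P : sobolevSpace hv ω := ⟨(S : strip ω → ℂ) * R, mul_mem_sobolevSpace hv hω S.2 R.2⟩
  have key : S - R = (l - m) • P := by
    apply Subtype.ext
    funext z
    have h1 := hne l hl z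
    have h2 := hne m hm z
    simp only [P, hS, hRdef, resFun, Submodule.coe_sub, Submodule.coe_smul, Pi.sub_apply,
      Pi.smul_apply, Pi.mul_apply, smul_eq_mul]
    field_simp
    ring
  have key' := congrArg Ψ key
  rw [map_sub, map_smul] at key'
  refine hR.of_resolvent_eq ?_ ?_
  · rw [key', hΨ.map_mul S R P rfl]
  · rw [key', hΨ.map_mul R S P (mul_comm _ _)]

theorem resolventOp_eq (hΨ : IsBoundedCalculus hv ω A Ψ) (hω : 0 ≤ ω) {m : ℂ} (hm : ω < |m.im|) :
    resolventOp A m = Ψ (resFun hv hω hm) :=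
  (hΨ.isResolventAt hω hm).resolventOp_eq

/-- The calculus on the level of `L²(ℝ)`. -/
theorem exists_clm (hΨ : IsBoundedCalculus hv ω A Ψ) (hω : 0 ≤ ω) :
    ∃ Φ : Lp ℂ 2 (volume : Measure ℝ) →L[ℂ] (X →L[ℂ] X), ∀ h, Φ h = Ψ (sobolevOfL2 hv hω h) := by
  obtain ⟨C, hC⟩ := hΨ.bound
  refine ⟨(Ψ ∘ₗ sobolevOfL2 hv hω).mkContinuous C fun h => ?_, fun h => rfl⟩
  have h1 := (hC (sobolevOfL2 hv hω h)).trans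
    (mul_le_mul_right (sobolevNorm_sobolevOfL2_le hv hω h) (C : ℝ≥0∞))
  rw [enorm_eq_nnnorm, enorm_eq_nnnorm, ← ENNReal.coe_mul, ENNReal.coe_le_coe] at h1
  exact_mod_cast h1

theorem integrable_smul_resL2 (hω : 0 ≤ ω) {θ r : ℝ} (hr : ω < |r|) (hrθ : |r| < θ) {ψ : ℂ → ℂ}
    (hψ : ψ ∈ elementary θ) : Integrable fun s : ℝ =>
      ψ ((s : ℂ) + (r : ℂ) * Complex.I) • resL2 hv hω (abs_im_line hr s) := by
  obtain ⟨C, hC⟩ := norm_resL2_line_le hv hω hr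
  exact (integrable_line_of_mem_elementary hrθ hψ).smul_bdd C
    (continuous_resL2_line hv hω hr).aestronglyMeasurable (Eventually.of_forall hC)

/-- On elementary functions the Sobolev calculus is given by the Cauchy integral. -/
theorem exists_eq_cauchyOp [CompleteSpace X] (hΨ : IsBoundedCalculus hv ω A Ψ) (hω : 0 ≤ ω) {θ δ : ℝ}
    (hδ : ω < δ) (hδθ : δ < θ) {ψ : ℂ → ℂ} (hψ : ψ ∈ elementary θ) :
    ∃ p : sobolevSpace hv ω, (p : strip ω → ℂ) = toStrip ω ψ ∧ Ψ p = cauchyOp A δ ψ := by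
  have hδ0 : 0 < δ := hω.trans_lt hδ
  have h1 : ω < |(-δ)| := by rwa [abs_neg, abs_of_pos hδ0]
  have h2 : ω < |δ| := by rwa [abs_of_pos hδ0]
  have h1' : |(-δ)| < θ := by rwa [abs_neg, abs_of_pos hδ0]
  have h2' : |δ| < θ := by rwa [abs_of_pos hδ0]
  have i1 := integrable_smul_resL2 (hv := hv) hω h1 h1' hψ
  have i2 := integrable_smul_resL2 (hv := hv) hω h2 h2' hψ
  -- The Cauchy integral, formed in `L²(ℝ)`: continuous evaluations identify its transform with `ψ`,
  -- and the bounded map `Φ` identifies its image with the integral of resolvents.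
  let H : Lp ℂ 2 (volume : Measure ℝ) := (2 * (Real.pi : ℂ) * Complex.I)⁻¹ •
    ((∫ s : ℝ, ψ ((s : ℂ) + ((-δ : ℝ) : ℂ) * Complex.I) • resL2 hv hω (abs_im_line h1 s)) -
      ∫ s : ℝ, ψ ((s : ℂ) + (δ : ℂ) * Complex.I) • resL2 hv hω (abs_im_line h2 s))
  refine ⟨sobolevOfL2 hv hω H, ?_, ?_⟩
  · funext z
    obtain ⟨ev, hev⟩ := exists_eval_clm hv hω z
    have hz : |(z : ℂ).im| < δ := (abs_im_le_of_mem_strip z.2).trans_lt hδ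
    have hpi : (2 * (Real.pi : ℂ) * Complex.I) ≠ 0 := by
      simp [Complex.I_ne_zero, Real.pi_ne_zero]
    rw [← hev, map_smul, map_sub, ← ev.integral_comp_comm i1, ← ev.integral_comp_comm i2]
    have hres : ∀ (l : ℂ) (hl : ω < |l.im|), ev (resL2 hv hω hl) = (l - (z : ℂ))⁻¹ := fun l hl => by
      rw [hev, sobolevOfL2_resL2, resFun]
    simp only [map_smul, hres, smul_eq_mul]
    rw [cauchy_strip hδθ hψ hz, inv_mul_cancel_left₀ hpi, toStrip]
  · obtain ⟨Φ, hΦ⟩ := hΨ.exists_clm hω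
    rw [← hΦ, map_smul, map_sub, ← Φ.integral_comp_comm i1, ← Φ.integral_comp_comm i2]
    simp only [map_smul, hΦ, sobolevOfL2_resL2, ← hΨ.resolventOp_eq hω]
    rw [cauchyOp]
    simp only [Complex.ofReal_neg, neg_mul, ← sub_eq_add_neg]

/-- The Cauchy integral represents `Ψ` for every admissible `δ`, so the arbitrary choice made in
`elemCalc` is harmless. -/
theorem exists_eq_elemCalc [CompleteSpace X] (hΨ : IsBoundedCalculus hv ω A Ψ) (hω : 0 ≤ ω)
    {ψ : ℂ → ℂ} (hψ : ψ ∈ elementaryGerm ω) :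
    ∃ p : sobolevSpace hv ω, (p : strip ω → ℂ) = toStrip ω ψ ∧ Ψ p = elemCalc ω A ψ := by
  obtain ⟨θ, hθ, hψ⟩ := hψ
  have hex : ∃ δ, ω < δ ∧ ∃ θ, δ < θ ∧ ψ ∈ elementary θ :=
    ⟨(ω + θ) / 2, by linarith, θ, by linarith, hψ⟩
  obtain ⟨h1, θ', h2, h3⟩ := hex.choose_spec
  rw [elemCalc, dif_pos hex]
  exact hΨ.exists_eq_cauchyOp hω h1 h2 h3

end IsBoundedCalculus

/-! ### Gaussian functions -/

/-- An integrable function with vanishing Fourier transform vanishes. -/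
theorem ae_eq_zero_of_fourier_eq_zero {u : ℝ → ℂ} (hu : Integrable u)
    (h : ∀ t : ℝ, ∫ s : ℝ, Complex.exp (-Complex.I * s * t) * u s = 0) : u =ᵐ[volume] 0 := by
  open scoped FourierTransform ContDiff in
  refine ae_eq_zero_of_integral_contDiff_smul_eq_zero hu.locallyIntegrable fun g hg hgs => ?_
  have hg₁ : HasCompactSupport (Complex.ofRealCLM ∘ g) := hgs.comp_left rfl
  have hg₂ : ContDiff ℝ ∞ (Complex.ofRealCLM ∘ g) := by fun_prop
  let φ : SchwartzMap ℝ ℂ := hg₁.toSchwartzMap hg₂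
  have hF : ∀ ξ : ℝ, 𝓕 u ξ = 0 := by
    intro ξ
    rw [Real.fourier_eq', ← h (2 * Real.pi * ξ)]
    refine integral_congr_ae (Eventually.of_forall fun s => ?_)
    simp only [smul_eq_mul]
    congr 2
    simp
    ring
  -- The test function is the Fourier transform of a Schwartz function; the transform is moved onto
  -- `u`, where it vanishes.
  have key : ∫ s, (𝓕 (𝓕⁻ φ) : SchwartzMap ℝ ℂ) s • u s = ∫ s, (𝓕⁻ φ) s • 𝓕 u s := by
    generalize 𝓕⁻ φ = χ
    rw [SchwartzMap.fourier_coe]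
    simpa using! VectorFourier.integral_fourierIntegral_smul_eq_flip (L := innerₗ ℝ)
      Real.continuous_fourierChar continuous_inner (χ.integrable (μ := volume)) hu
  rw [FourierTransform.fourier_fourierInv_eq] at key
  simp only [hF, smul_zero, integral_zero] at key
  rw [← key]
  refine integral_congr_ae (Eventually.of_forall fun s => ?_)
  simp [φ]

/-- The modulated Gaussian `e^{-c s²} e^{ist}`. -/
def modGauss (c t s : ℝ) : ℂ := Complex.exp (Complex.I * t * s) * Complex.exp (-c * s ^ 2)

theorem norm_modGauss (c t s : ℝ) : ‖modGauss c t s‖ = Real.exp (-c * s ^ 2) := by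
  rw [modGauss, norm_mul, Complex.norm_exp, Complex.norm_exp]
  have e1 : (Complex.I * t * s).re = 0 := by simp
  have e2 : (-(c : ℂ) * s ^ 2).re = -c * s ^ 2 := by
    rw [← Complex.ofReal_pow, ← Complex.ofReal_neg, ← Complex.ofReal_mul, Complex.ofReal_re]
  rw [e1, e2, Real.exp_zero, one_mul]

theorem continuous_modGauss (c t : ℝ) : Continuous (modGauss c t) := by
  unfold modGauss; fun_prop

theorem memWeightedL2_modGauss {v : ℝ → ℝ} (hv : StronglyAdmissible v) {ω : ℝ} (hω : 0 ≤ ω)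
    {c : ℝ} (hc : 0 < c) (t : ℝ) : MemWeightedL2 v ω (modGauss c t) := by
  refine memWeightedL2_of_norm_le_exp hv hω (C := Real.exp ((ω + 1) ^ 2 / (4 * c))) (δ := ω + 1)
    (continuous_modGauss c t).aestronglyMeasurable (by linarith) fun s => ?_
  rw [norm_modGauss, ← Real.exp_add, Real.exp_le_exp]
  -- Completing the square; the constant `e^{(ω+1)²/(4c)}` is the maximum of `e^{(ω+1)|s| - c s²}`.
  have h : (ω + 1) ^ 2 / (4 * c) + -(ω + 1) * |s| + c * |s| ^ 2 =
      c * (|s| - (ω + 1) / (2 * c)) ^ 2 := by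
    field_simp; ring
  have h2 : 0 ≤ c * (|s| - (ω + 1) / (2 * c)) ^ 2 := by positivity
  rw [sq_abs] at h
  linarith

theorem fourierStrip_modGauss (ω : ℝ) {c : ℝ} (hc : 0 < c) (t : ℝ) :
    fourierStrip ω (modGauss c t) = fun z : strip ω =>
      ((Real.pi : ℂ) / c) ^ (1 / 2 : ℂ) * Complex.exp (-((z : ℂ) - t) ^ 2 / (4 * c)) := by
  funext z
  have := fourierIntegral_gaussian (b := (c : ℂ)) (by simpa using hc) ((t : ℂ) - z)
  rw [fourierStrip, show -((z : ℂ) - t) ^ 2 = -((t : ℂ) - z) ^ 2 by ring, ← this]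
  refine integral_congr_ae (Eventually.of_forall fun s => ?_)
  simp only [modGauss]
  rw [← mul_assoc, ← Complex.exp_add]
  congr 2
  ring

/-- The function in `L²(ℝ)` which represents the transform of a modulated Gaussian. -/
def modGaussL2 {v : ℝ → ℝ} (hv : StronglyAdmissible v) {ω : ℝ} (hω : 0 ≤ ω)
    {c : ℝ} (hc : 0 < c) (t : ℝ) : Lp ℂ 2 (volume : Measure ℝ) :=
  (memWeightedL2_modGauss hv hω hc t).2.toLp _

theorem sobolevOfL2_modGaussL2 {v : ℝ → ℝ} (hv : StronglyAdmissible v) {ω : ℝ} (hω : 0 ≤ ω)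
    {c : ℝ} (hc : 0 < c) (t : ℝ) : (sobolevOfL2 hv hω (modGaussL2 hv hω hc t) : strip ω → ℂ) =
      fun z : strip ω =>
        ((Real.pi : ℂ) / c) ^ (1 / 2 : ℂ) * Complex.exp (-((z : ℂ) - t) ^ 2 / (4 * c)) :=
  (sobolevOfL2_toLp hv hω (memWeightedL2_modGauss hv hω hc t)).trans (fourierStrip_modGauss ω hc t)

/-- The modulated Gaussians of a fixed width are total. -/
theorem span_modGaussL2_dense {v : ℝ → ℝ} (hv : StronglyAdmissible v) {ω : ℝ} (hω : 0 ≤ ω)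
    {c : ℝ} (hc : 0 < c) :
    (Submodule.span ℂ (Set.range (modGaussL2 hv hω hc))).topologicalClosure = ⊤ := by
  rw [Submodule.topologicalClosure_eq_top_iff, Submodule.eq_bot_iff]
  intro q hq
  have hM := memWeightedL2_modGauss hv hω hc 0
  have hint : Integrable (fun s => weighted v ω (modGauss c 0) s * q s) :=
    hM.2.integrable_mul (Lp.memLp q)
  -- Orthogonality to all modulations says that the Fourier transform of this product vanishes. The
  -- Gaussian factor has no zeros, so `q` itself vanishes.
  have hzero := ae_eq_zero_of_fourier_eq_zero hint fun t => by
    have h0 := (Submodule.mem_orthogonal _ _).1 hq _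
      (Submodule.subset_span (Set.mem_range_self t))
    rw [L2.inner_def] at h0
    rw [← h0]
    refine integral_congr_ae ?_
    filter_upwards [(memWeightedL2_modGauss hv hω hc t).2.coeFn_toLp] with s hs
    rw [modGaussL2, hs]
    simp only [RCLike.inner_apply, weighted_apply, modGauss, map_mul, ← Complex.exp_conj,
      Complex.conj_ofReal, Complex.conj_I, map_neg, map_pow, Complex.ofReal_zero, mul_zero,
      zero_mul, Complex.exp_zero, one_mul]
    ring_nf
  apply Lp.ext
  filter_upwards [hzero, Lp.coeFn_zero ℂ 2 (volume : Measure ℝ)] with s h1 h2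
  rw [h2, Pi.zero_apply]
  have h3 : weighted v ω (modGauss c 0) s ≠ 0 := by
    rw [weighted_apply]
    refine mul_ne_zero (by exact_mod_cast (weight_pos hv ω s).ne') ?_
    exact mul_ne_zero (Complex.exp_ne_zero _) (Complex.exp_ne_zero _)
  exact (mul_eq_zero.1 h1).resolve_left h3

/-! ### Elementary functions -/

theorem add_mem_elementary {θ : ℝ} {ψ φ : ℂ → ℂ} (hψ : ψ ∈ elementary θ) (hφ : φ ∈ elementary θ) :
    ψ + φ ∈ elementary θ := by
  obtain ⟨C, hC⟩ := hψ.2.1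
  obtain ⟨K, hK⟩ := hφ.2.1
  refine ⟨hψ.1.add hφ.1, ⟨C + K, fun z hz => (norm_add_le _ _).trans (add_le_add (hC z hz) (hK z hz))⟩,
    lt_of_le_of_lt ?_ (ENNReal.add_lt_top.2 ⟨hψ.2.2, hφ.2.2⟩)⟩
  refine iSup₂_le fun r hr => ?_
  refine le_trans ?_ (add_le_add
    (le_iSup₂ (f := fun (r : ℝ) (_ : |r| < θ) =>
      ∫⁻ s : ℝ, ‖ψ ((s : ℂ) + (r : ℂ) * Complex.I)‖ₑ) r hr)
    (le_iSup₂ (f := fun (r : ℝ) (_ : |r| < θ) =>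
      ∫⁻ s : ℝ, ‖φ ((s : ℂ) + (r : ℂ) * Complex.I)‖ₑ) r hr))
  rw [← lintegral_add_left (continuous_line_of_mem_elementary hr hψ).measurable.enorm]
  exact lintegral_mono fun s => enorm_add_le _ _

theorem smul_mem_elementary {θ : ℝ} {ψ : ℂ → ℂ} (c : ℂ) (hψ : ψ ∈ elementary θ) :
    c • ψ ∈ elementary θ := by
  obtain ⟨C, hC⟩ := hψ.2.1
  refine ⟨hψ.1.const_smul c, ⟨‖c‖ * C, fun z hz => ?_⟩,
    lt_of_le_of_lt ?_ (ENNReal.mul_lt_top (enorm_lt_top (x := c)) hψ.2.2)⟩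
  · rw [Pi.smul_apply, norm_smul]
    exact mul_le_mul_of_nonneg_left (hC z hz) (norm_nonneg _)
  · refine iSup₂_le fun r hr => ?_
    simp only [Pi.smul_apply, enorm_smul]
    rw [lintegral_const_mul _ (continuous_line_of_mem_elementary hr hψ).measurable.enorm]
    gcongr
    exact le_iSup₂ (f := fun (r : ℝ) (_ : |r| < θ) =>
      ∫⁻ s : ℝ, ‖ψ ((s : ℂ) + (r : ℂ) * Complex.I)‖ₑ) r hr

theorem zero_mem_elementary (θ : ℝ) : (0 : ℂ → ℂ) ∈ elementary θ :=
  ⟨differentiableOn_const 0, ⟨0, fun z _ => by simp⟩, by simp⟩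

theorem gaussian_mem_elementary (θ : ℝ) {a : ℝ} (ha : 0 < a) (t : ℝ) :
    (fun z : ℂ => Complex.exp (-(a : ℂ) * (z - t) ^ 2)) ∈ elementary θ := by
  have hre : ∀ z : ℂ, (-(a : ℂ) * (z - t) ^ 2).re = a * z.im ^ 2 + -a * (z.re - t) ^ 2 := by
    intro z
    simp [sq]
    ring
  have hle : ∀ z ∈ openStrip θ, ‖Complex.exp (-(a : ℂ) * (z - t) ^ 2)‖ ≤
      Real.exp (a * θ ^ 2) * Real.exp (-a * (z.re - t) ^ 2) := by
    intro z hz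
    rw [Complex.norm_exp, hre, ← Real.exp_add, Real.exp_le_exp]
    have hz' : |z.im| < θ := hz
    have : z.im ^ 2 ≤ θ ^ 2 := sq_le_sq' (by linarith [(abs_lt.1 hz').1]) (abs_lt.1 hz').2.le
    nlinarith
  refine ⟨by fun_prop, ⟨Real.exp (a * θ ^ 2), fun z hz => (hle z hz).trans ?_⟩, ?_⟩
  · refine mul_le_of_le_one_right (Real.exp_pos _).le (Real.exp_le_one_iff.2 ?_)
    have : 0 ≤ a * (z.re - t) ^ 2 := by positivity
    linarith
  · have hint : Integrable fun s : ℝ => Real.exp (a * θ ^ 2) * Real.exp (-a * (s - t) ^ 2) :=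
      ((integrable_exp_neg_mul_sq ha).comp_sub_right t).const_mul _
    refine lt_of_le_of_lt (iSup₂_le fun r hr => ?_) hint.2
    refine lintegral_mono fun s => ?_
    have := hle _ (line_mem_openStrip hr s)
    simp only [Complex.add_re, Complex.ofReal_re, Complex.mul_re, Complex.I_re, mul_zero,
      Complex.ofReal_im, Complex.I_im, mul_one, sub_self, add_zero] at this
    rw [enorm_le_iff_norm_le]
    exact this.trans (le_abs_self _)

/-- Multiples of transforms of modulated Gaussians, given by elementary functions. -/
theorem exists_elementary_of_mem_span {v : ℝ → ℝ} (hv : StronglyAdmissible v) {ω : ℝ} (hω : 0 ≤ ω)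
    {c : ℝ} (hc : 0 < c) (θ : ℝ) {h : Lp ℂ 2 (volume : Measure ℝ)}
    (hh : h ∈ Submodule.span ℂ (Set.range (modGaussL2 hv hω hc))) :
    ∃ ψ ∈ elementary θ, toStrip ω ψ = sobolevOfL2 hv hω h := by
  induction hh using Submodule.span_induction with
  | mem h hh =>
    obtain ⟨t, rfl⟩ := hh
    -- The transform of `e^{-cs²}` is a multiple of `e^{-z²/(4c)}`.
    refine ⟨_, smul_mem_elementary (((Real.pi : ℂ) / c) ^ (1 / 2 : ℂ))
      (gaussian_mem_elementary θ (a := (4 * c)⁻¹) (by positivity) t), ?_⟩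
    rw [sobolevOfL2_modGaussL2]
    funext z
    simp only [toStrip, Pi.smul_apply, smul_eq_mul]
    congr 2
    push_cast
    ring
  | zero => exact ⟨0, zero_mem_elementary θ, by rw [map_zero]; rfl⟩
  | add h k _ _ ih ik =>
    obtain ⟨ψ, hψ, e⟩ := ih
    obtain ⟨φ, hφ, e'⟩ := ik
    refine ⟨ψ + φ, add_mem_elementary hψ hφ, ?_⟩
    rw [map_add, Submodule.coe_add, ← e, ← e']
    rfl
  | smul a h _ ih =>
    obtain ⟨ψ, hψ, e⟩ := ih
    refine ⟨a • ψ, smul_mem_elementary a hψ, ?_⟩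
    rw [map_smul, Submodule.coe_smul, ← e]
    rfl

/-! ### Injectivity of the Gaussian operator, and agreement of the elementary Sobolev calculus with
`Ψ` -/

namespace IsBoundedCalculus

variable {v : ℝ → ℝ} {hv : StronglyAdmissible v} {ω : ℝ} {A : X →ₗ.[ℂ] X}
  {Ψ : sobolevSpace hv ω →ₗ[ℂ] (X →L[ℂ] X)}

/-- Convergence in the Sobolev norm implies convergence of the operators. -/
theorem tendsto_of_sobolevNorm (hΨ : IsBoundedCalculus hv ω A Ψ) {f : ℕ → sobolevSpace hv ω}
    (hf : Tendsto (fun n => sobolevNorm v ω (f n)) atTop (𝓝 0)) :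
    Tendsto (fun n => Ψ (f n)) atTop (𝓝 0) := by
  obtain ⟨C, hC⟩ := hΨ.bound
  rw [tendsto_zero_iff_norm_tendsto_zero]
  have h1 : Tendsto (fun n => (C : ℝ≥0∞) * sobolevNorm v ω (f n)) atTop (𝓝 0) := by
    have := ENNReal.Tendsto.const_mul (a := (C : ℝ≥0∞)) hf (Or.inr ENNReal.coe_ne_top)
    rwa [mul_zero] at this
  have h2 := tendsto_of_tendsto_of_tendsto_of_le_of_le tendsto_const_nhds h1
    (fun n => zero_le (a := ‖Ψ (f n)‖ₑ)) (fun n => hC (f n))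
  have h3 := (ENNReal.tendsto_toReal ENNReal.zero_ne_top).comp h2
  simpa [Function.comp_def] using h3

/-- The Gaussian acts injectively. -/
theorem injective_gauss (hΨ : IsBoundedCalculus hv ω A Ψ) (hω : 0 ≤ ω) {G : sobolevSpace hv ω}
    (hG : (G : strip ω → ℂ) = toStrip ω gauss) {x : X} (hx : Ψ G x = 0) : x = 0 := by
  obtain ⟨Φ, hΦ⟩ := hΨ.exists_clm hω
  -- Widths `1/8` and `1/4` correspond to `e^{-2(z-t)²}` and `e^{-(z-2t)²}`. The identity `2(z-t)² =
  -- (z-2t)² + z² - 2t²` makes every narrow Gaussian a multiple of `G` within the algebra.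
  have hc : (0 : ℝ) < 1 / 8 := by norm_num
  have hc' : (0 : ℝ) < 1 / 4 := by norm_num
  have hgauss : ∀ t, Φ (modGaussL2 hv hω hc t) x = 0 := by
    intro t
    obtain ⟨a, ha⟩ : ∃ a : ℂ, a = ((Real.pi : ℂ) / (1 / 8 : ℝ)) ^ (1 / 2 : ℂ) := ⟨_, rfl⟩
    obtain ⟨b, hb⟩ : ∃ b : ℂ, b = ((Real.pi : ℂ) / (1 / 4 : ℝ)) ^ (1 / 2 : ℂ) := ⟨_, rfl⟩
    have hb0 : b ≠ 0 := by
      rw [hb, Complex.cpow_ne_zero_iff_of_exponent_ne_zero (by norm_num)]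
      refine div_ne_zero ?_ ?_
      · exact_mod_cast Real.pi_ne_zero
      · norm_num
    set P := (a * b⁻¹ * Complex.exp (2 * t ^ 2)) • sobolevOfL2 hv hω (modGaussL2 hv hω hc' (2 * t))
    have hP : (sobolevOfL2 hv hω (modGaussL2 hv hω hc t) : strip ω → ℂ) =
        (P : strip ω → ℂ) * (G : strip ω → ℂ) := by
      funext z
      rw [Pi.mul_apply, Submodule.coe_smul, Pi.smul_apply, sobolevOfL2_modGaussL2,
        sobolevOfL2_modGaussL2, hG, ← ha, ← hb, toStrip, gauss, smul_eq_mul]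
      have e : Complex.exp (-((z : ℂ) - t) ^ 2 / (4 * (1 / 8 : ℝ))) =
          Complex.exp (2 * t ^ 2) * Complex.exp (-((z : ℂ) - (2 * t : ℝ)) ^ 2 / (4 * (1 / 4 : ℝ))) *
            Complex.exp (-(z : ℂ) ^ 2) := by
        rw [← Complex.exp_add, ← Complex.exp_add]
        congr 1
        push_cast
        ring
      beta_reduce
      rw [e]
      field_simp
    rw [hΦ, hΨ.map_mul _ _ _ hP, mul_apply_eq_comp, hx, map_zero]
  have hall : ∀ h, Φ h x = 0 := by
    have hK : Submodule.span ℂ (Set.range (modGaussL2 hv hω hc)) ≤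
        LinearMap.ker ((ContinuousLinearMap.apply ℂ X x ∘L Φ : _ →L[ℂ] X) : _ →ₗ[ℂ] X) := by
      rw [Submodule.span_le]
      rintro _ ⟨t, rfl⟩
      exact hgauss t
    have hcl := Submodule.topologicalClosure_minimal _ hK
      (ContinuousLinearMap.isClosed_ker (ContinuousLinearMap.apply ℂ X x ∘L Φ))
    rw [span_modGaussL2_dense] at hcl
    exact fun h => hcl (Submodule.mem_top (x := h))
  -- By totality every operator in the range of `Ψ` kills `x`; one of them is an injective
  -- resolvent.
  obtain ⟨l, hl, r, -, hR⟩ := hΨ.resolvent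
  obtain ⟨k, hk⟩ := exists_sobolevOfL2_eq hv hω r
  have h0 : Ψ r x = 0 := by rw [← hk, ← hΦ, hall]
  obtain ⟨hdom, he⟩ := hR.1 x
  have h1 : (⟨Ψ r x, hdom⟩ : A.domain) = 0 := Subtype.ext h0
  rw [h1, h0, smul_zero, A.map_zero, sub_zero] at he
  exact he.symm

variable [CompleteSpace X]

/-- The elementary Sobolev calculus is a restriction of `Ψ`. -/
theorem eq_of_sobolevCalc (hΨ : IsBoundedCalculus hv ω A Ψ) (hω : 0 ≤ ω) {f : strip ω → ℂ}
    {T : X →L[ℂ] X} (h : SobolevCalc hv ω A f T) : ∃ hf : f ∈ sobolevSpace hv ω, Ψ ⟨f, hf⟩ = T := by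
  obtain ⟨hf, ψ, hψ, h1, h2⟩ := h
  refine ⟨hf, ?_⟩
  choose p hp hp' using fun n => hΨ.exists_eq_elemCalc hω (hψ n)
  have h3 : Tendsto (fun n => Ψ (p n - ⟨f, hf⟩)) atTop (𝓝 0) := by
    refine hΨ.tendsto_of_sobolevNorm ?_
    simpa only [Submodule.coe_sub, hp] using h1
  have h4 : Tendsto (fun n => Ψ (p n)) atTop (𝓝 (Ψ ⟨f, hf⟩)) := by
    simp only [map_sub] at h3
    exact tendsto_sub_nhds_zero_iff.1 h3
  simp only [hp'] at h4
  exact tendsto_nhds_unique h4 h2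

/-- The elementary Sobolev calculus is defined on the whole Sobolev space. -/
theorem sobolevCalc (hΨ : IsBoundedCalculus hv ω A Ψ) (hω : 0 ≤ ω) (f : sobolevSpace hv ω) :
    SobolevCalc hv ω A f (Ψ f) := by
  refine ⟨f.2, ?_⟩
  obtain ⟨h, rfl⟩ := exists_sobolevOfL2_eq hv hω f
  obtain ⟨Φ, hΦ⟩ := hΨ.exists_clm hω
  have hmem : h ∈ closure (Submodule.span ℂ (Set.range (modGaussL2 hv hω one_pos)) :
      Set (Lp ℂ 2 (volume : Measure ℝ))) := by
    rw [← Submodule.topologicalClosure_coe, span_modGaussL2_dense]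
    trivial
  obtain ⟨k, hk, hlim⟩ := mem_closure_iff_seq_limit.1 hmem
  choose ψ hψ e using fun n => exists_elementary_of_mem_span hv hω one_pos (ω + 1) (hk n)
  have hgerm : ∀ n, ψ n ∈ elementaryGerm ω := fun n => ⟨ω + 1, by linarith, hψ n⟩
  refine ⟨ψ, hgerm, ?_, ?_⟩
  · have h1 : Tendsto (fun n => ‖k n - h‖ₑ) atTop (𝓝 0) := by
      have := (tendsto_sub_nhds_zero_iff.2 hlim).enorm
      simpa using this
    refine tendsto_of_tendsto_of_tendsto_of_le_of_le tendsto_const_nhds h1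
      (fun n => zero_le) (fun n => ?_)
    simp only [e]
    rw [← Submodule.coe_sub, ← map_sub]
    exact sobolevNorm_sobolevOfL2_le hv hω _
  · have h1 : ∀ n, elemCalc ω A (ψ n) = Φ (k n) := by
      intro n
      obtain ⟨p, hp, hp'⟩ := hΨ.exists_eq_elemCalc hω (hgerm n)
      rw [← hp', hΦ]
      congr 1
      exact Subtype.ext (hp.trans (e n))
    simp only [h1, ← hΦ]
    exact (Φ.continuous.tendsto h).comp hlim

end IsBoundedCalculus

/-! ### The convergence lemma -/

/-- A bounded sequence of operators which converges strongly on a dense subspace converges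
strongly. -/
theorem cauchySeq_apply_of_dense {T : ℕ → X →L[ℂ] X} {C : ℝ} (hC : ∀ n, ‖T n‖ ≤ C)
    {s : Set X} (hs : Dense s) (h : ∀ u ∈ s, CauchySeq fun n => T n u) (x : X) :
    CauchySeq fun n => T n x := by
  have hC0 : 0 ≤ C := (norm_nonneg _).trans (hC 0)
  rw [Metric.cauchySeq_iff']
  intro ε hε
  -- `C + 1` replaces `C` so that the denominator is nonzero.
  have hδ : 0 < ε / (3 * (C + 1)) := by positivity
  obtain ⟨u, hu, hxu⟩ := Metric.mem_closure_iff.1 (hs x) _ hδ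
  obtain ⟨N, hN⟩ := Metric.cauchySeq_iff'.1 (h u hu) (ε / 3) (by positivity)
  refine ⟨N, fun n hn => ?_⟩
  have hT : ∀ n, dist (T n x) (T n u) < ε / 3 := by
    intro n
    rw [dist_eq_norm] at hxu ⊢
    rw [← map_sub]
    calc ‖T n (x - u)‖ ≤ C * ‖x - u‖ := (T n).le_of_opNorm_le (hC n) _
      _ ≤ (C + 1) * ‖x - u‖ := by nlinarith [norm_nonneg (x - u)]
      _ < (C + 1) * (ε / (3 * (C + 1))) := mul_lt_mul_of_pos_left hxu (by linarith)
      _ = ε / 3 := by field_simp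
  calc dist (T n x) (T N x)
      ≤ dist (T n x) (T n u) + dist (T n u) (T N u) + dist (T N u) (T N x) := dist_triangle4 _ _ _ _
    _ < ε / 3 + ε / 3 + ε / 3 := by
        have h1 := hT n
        have h2 := hN n hn
        have h3 := hT N
        rw [dist_comm (T N u)]
        linarith
    _ = ε := by ring

theorem gauss_mem_elementaryGerm (ω : ℝ) : gauss ∈ elementaryGerm ω := by
  refine ⟨ω + 1, by linarith, ?_⟩
  convert gaussian_mem_elementary (ω + 1) one_pos 0 using 2 with z
  simp [gauss]

/-- Only the translate `t = 0` in the Hörmander norm is needed. -/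
theorem gauss_mul_mem_sobolevSpace {v : ℝ → ℝ} (hv : StronglyAdmissible v) {ω : ℝ}
    {f : strip ω → ℂ} (hf : f ∈ horSpace v ω) : toStrip ω gauss * f ∈ sobolevSpace hv ω := by
  refine mem_sobolevSpace_of_sobolevNorm_lt_top hv (lt_of_le_of_lt (le_of_eq ?_)
    ((le_iSup (fun t : ℝ => sobolevNorm v ω (fun z => gauss ((z : ℂ) - t) * f z)) 0).trans_lt hf))
  simp only [Complex.ofReal_zero, sub_zero]
  rfl

namespace IsBoundedCalculus

variable {v : ℝ → ℝ} {hv : StronglyAdmissible v} {ω : ℝ} {A : X →ₗ.[ℂ] X}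
  {Ψ : sobolevSpace hv ω →ₗ[ℂ] (X →L[ℂ] X)}

/-- Convergence on the range of `ψ(A)`. -/
theorem exists_tendsto_apply (hΨ : IsBoundedCalculus hv ω A Ψ) (hω : 0 ≤ ω)
    {G Gf p : sobolevSpace hv ω} {GF : ℕ → sobolevSpace hv ω} {f : strip ω → ℂ}
    {F : ℕ → strip ω → ℂ} (hG : (G : strip ω → ℂ) = toStrip ω gauss)
    (hGf : (Gf : strip ω → ℂ) = toStrip ω gauss * f)
    (hGF : ∀ n, (GF n : strip ω → ℂ) = toStrip ω gauss * F n) {T : ℕ → X →L[ℂ] X}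
    (hT : ∀ n x, Ψ G (T n x) = Ψ (GF n) x)
    (hconv : Tendsto (fun n => sobolevNorm v ω ((p : strip ω → ℂ) * (F n - f))) atTop (𝓝 0))
    (y : X) : ∃ c, Tendsto (fun n => T n (Ψ p y)) atTop (𝓝 c) ∧ Ψ G c = Ψ Gf (Ψ p y) := by
  classical
  have hmem : ∀ᶠ n in atTop, (p : strip ω → ℂ) * (F n - f) ∈ sobolevSpace hv ω := by
    filter_upwards [hconv.eventually (gt_mem_nhds (ENNReal.zero_lt_top))] with n hn
    exact mem_sobolevSpace_of_sobolevNorm_lt_top hv hn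
  -- The default value `0` occurs only for finitely many `n`, where the Sobolev norm may be
  -- infinite.
  let E : ℕ → sobolevSpace hv ω := fun n =>
    if h : (p : strip ω → ℂ) * (F n - f) ∈ sobolevSpace hv ω then ⟨_, h⟩ else 0
  have hE : ∀ᶠ n in atTop, (E n : strip ω → ℂ) = (p : strip ω → ℂ) * (F n - f) := by
    filter_upwards [hmem] with n hn
    simp only [E, dif_pos hn]
  have hE0 : Tendsto (fun n => Ψ (E n)) atTop (𝓝 0) := by
    refine hΨ.tendsto_of_sobolevNorm (hconv.congr' ?_)
    filter_upwards [hE] with n hn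
    rw [hn]
  have hE1 : Tendsto (fun n => Ψ (E n) y) atTop (𝓝 0) := by
    have := ((ContinuousLinearMap.apply ℂ X y).continuous.tendsto 0).comp hE0
    simpa [Function.comp_def] using this
  -- The right-hand side is independent of `n`: this is `G (F n) p = G f p + G p (F n - f)` under
  -- `Ψ`.
  have key : ∀ᶠ n in atTop, Ψ G (T n (Ψ p y) - Ψ (E n) y) = Ψ Gf (Ψ p y) := by
    filter_upwards [hE] with n hn
    have h1 := hΨ.map_mul (GF n) p ⟨_, mul_mem_sobolevSpace hv hω (GF n).2 p.2⟩ rfl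
    have h2 := hΨ.map_mul Gf p ⟨_, mul_mem_sobolevSpace hv hω Gf.2 p.2⟩ rfl
    have h3 := hΨ.map_mul G (E n) ⟨_, mul_mem_sobolevSpace hv hω G.2 (E n).2⟩ rfl
    have h4 : (⟨_, mul_mem_sobolevSpace hv hω (GF n).2 p.2⟩ : sobolevSpace hv ω) =
        ⟨_, mul_mem_sobolevSpace hv hω Gf.2 p.2⟩ + ⟨_, mul_mem_sobolevSpace hv hω G.2 (E n).2⟩ := by
      apply Subtype.ext
      simp only [Submodule.coe_add, hn, hG, hGf, hGF]
      ring
    rw [map_sub, hT, ← mul_apply_eq_comp, ← mul_apply_eq_comp, ← mul_apply_eq_comp, ← h1, ← h2,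
      ← h3, h4, map_add, add_apply, add_sub_cancel_right]
  obtain ⟨N, hN⟩ := eventually_atTop.1 key
  -- By injectivity the vectors `T n (Ψ p y) - Ψ (E n) y` coincide for `n ≥ N`, and the correction
  -- tends to zero. The product `p f` itself need not be known to lie in the Sobolev space.
  refine ⟨T N (Ψ p y) - Ψ (E N) y, ?_, hN N le_rfl⟩
  have h1 := hE1.const_add (T N (Ψ p y) - Ψ (E N) y)
  rw [add_zero] at h1
  refine h1.congr' ?_
  filter_upwards [eventually_ge_atTop N] with n hn
  have h2 : Ψ G ((T n (Ψ p y) - Ψ (E n) y) - (T N (Ψ p y) - Ψ (E N) y)) = 0 := by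
    rw [map_sub, hN n hn, hN N le_rfl, sub_self]
  rw [← sub_eq_zero.1 (hΨ.injective_gauss hω hG h2), sub_add_cancel]

variable [CompleteSpace X]

/-- If `S` is the operator associated with `f` by the regularizer `e^{-z²}` then `f(A) = S`. -/
theorem funCalcEq (hΨ : IsBoundedCalculus hv ω A Ψ) (hω : 0 ≤ ω) {G Gf : sobolevSpace hv ω}
    {f : strip ω → ℂ} (hG : (G : strip ω → ℂ) = toStrip ω gauss)
    (hGf : (Gf : strip ω → ℂ) = toStrip ω gauss * f) {S : X →L[ℂ] X}
    (hS : ∀ x, Ψ G (S x) = Ψ Gf x) : FunCalcEq hv ω A f S := by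
  have hinj : ∀ x y, Ψ G x = Ψ G y → x = y := fun x y h =>
    sub_eq_zero.1 (hΨ.injective_gauss hω hG (by rw [map_sub, h, sub_self]))
  ext ⟨x, y⟩
  rw [LinearMap.mem_graph_iff]
  constructor
  · intro h
    refine hinj _ _ ?_
    have h1 := h _ _ _ (hΨ.sobolevCalc hω G) (by
      have := hΨ.sobolevCalc hω Gf
      rwa [hGf, ← hG] at this)
    rw [h1]
    exact (hS x).symm
  · rintro (h : y = S x) e T U hT hU
    subst h
    obtain ⟨he, rfl⟩ := hΨ.eq_of_sobolevCalc hω hT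
    obtain ⟨hef, rfl⟩ := hΨ.eq_of_sobolevCalc hω hU
    -- After applying `Ψ G`, commutativity gives `Ψ(G) Ψ(e) S x = Ψ(e) Ψ(G f) x = Ψ(G) Ψ(e f) x`.
    refine hinj _ _ ?_
    have h1 := hΨ.map_mul G ⟨e, he⟩ ⟨_, mul_mem_sobolevSpace hv hω G.2 he⟩ rfl
    have h2 := hΨ.map_mul ⟨e, he⟩ G ⟨_, mul_mem_sobolevSpace hv hω G.2 he⟩ (mul_comm _ _)
    have h3 := hΨ.map_mul ⟨e, he⟩ Gf ⟨_, mul_mem_sobolevSpace hv hω he Gf.2⟩ rfl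
    have h4 := hΨ.map_mul G ⟨_, hef⟩ ⟨_, mul_mem_sobolevSpace hv hω he Gf.2⟩ (by
      simp only [hG, hGf, mul_left_comm])
    simp only [← mul_apply_eq_comp]
    rw [← mul_assoc, ← h1, h2, ← h4, h3, mul_apply_eq_comp, mul_apply_eq_comp,
      mul_apply_eq_comp, hS]

/-- The Gaussian is one of the regularizers tested in the definition of `f(A)`, since the elementary
Sobolev calculus is defined on the whole Sobolev space. -/
theorem gauss_apply_of_funCalcEq (hΨ : IsBoundedCalculus hv ω A Ψ) (hω : 0 ≤ ω)
    {G Gf : sobolevSpace hv ω} {f : strip ω → ℂ} (hG : (G : strip ω → ℂ) = toStrip ω gauss)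
    (hGf : (Gf : strip ω → ℂ) = toStrip ω gauss * f) {S : X →L[ℂ] X}
    (hS : FunCalcEq hv ω A f S) (x : X) : Ψ G (S x) = Ψ Gf x := by
  have hx : (x, S x) ∈ funCalc hv ω A f := by
    rw [hS]
    exact (LinearMap.mem_graph_iff _ _).2 rfl
  refine hx _ _ _ (hΨ.sobolevCalc hω G) ?_
  have := hΨ.sobolevCalc hω Gf
  rwa [hGf, ← hG] at this

/-- Convergence lemma for the Sobolev calculus. -/
theorem convergence_lemma (hΨ : IsBoundedCalculus hv ω A Ψ) (hω : 0 ≤ ω)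
    {f : strip ω → ℂ} (hf : f ∈ horSpace v ω)
    {F : ℕ → strip ω → ℂ} (hF : ∀ n, F n ∈ horSpace v ω)
    {D : Set (ℂ → ℂ)} (hample : Ample ω A D)
    (hconv : ∀ ψ ∈ D, Tendsto
      (fun n => sobolevNorm v ω (toStrip ω ψ * (F n - f))) atTop (𝓝 0))
    {T : ℕ → X →L[ℂ] X} (hT : ∀ n, FunCalcEq hv ω A (F n) (T n))
    (hbdd : ∃ C : ℝ, ∀ n, ‖T n‖ ≤ C) :
    ∃ S : X →L[ℂ] X, FunCalcEq hv ω A f S ∧ ∀ x : X, Tendsto (fun n => T n x) atTop (𝓝 (S x)) := by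
  obtain ⟨G, hG, -⟩ := hΨ.exists_eq_elemCalc hω (gauss_mem_elementaryGerm ω)
  let Gf : sobolevSpace hv ω := ⟨_, gauss_mul_mem_sobolevSpace hv hf⟩
  let GF : ℕ → sobolevSpace hv ω := fun n => ⟨_, gauss_mul_mem_sobolevSpace hv (hF n)⟩
  have hGT : ∀ n x, Ψ G (T n x) = Ψ (GF n) x := fun n x =>
    hΨ.gauss_apply_of_funCalcEq hω hG rfl (hT n) x
  have hran : ∀ u ∈ ⋃ ψ ∈ D, Set.range (elemCalc ω A ψ),
      ∃ c, Tendsto (fun n => T n u) atTop (𝓝 c) ∧ Ψ G c = Ψ Gf u := by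
    intro u hu
    simp only [Set.mem_iUnion] at hu
    obtain ⟨ψ, hψ, y, rfl⟩ := hu
    obtain ⟨p, hp, hp'⟩ := hΨ.exists_eq_elemCalc hω (hample.1 hψ)
    rw [← hp']
    exact hΨ.exists_tendsto_apply hω hG rfl (fun n => rfl) hGT (by rw [hp]; exact hconv ψ hψ) y
  have hspan : ∀ u ∈ Submodule.span ℂ (⋃ ψ ∈ D, Set.range (elemCalc ω A ψ)),
      ∃ c, Tendsto (fun n => T n u) atTop (𝓝 c) ∧ Ψ G c = Ψ Gf u := by
    intro u hu
    induction hu using Submodule.span_induction with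
    | mem u hu => exact hran u hu
    | zero => exact ⟨0, by simp, by simp⟩
    | add u w _ _ hu hw =>
      obtain ⟨c, hc, hc'⟩ := hu
      obtain ⟨d, hd, hd'⟩ := hw
      exact ⟨c + d, by simpa using hc.add hd, by simp [hc', hd']⟩
    | smul a u _ hu =>
      obtain ⟨c, hc, hc'⟩ := hu
      exact ⟨a • c, by simpa using hc.const_smul a, by simp [hc']⟩
  have hdense : Dense (Submodule.span ℂ (⋃ ψ ∈ D, Set.range (elemCalc ω A ψ)) : Set X) :=
    dense_iff_closure_eq.2 hample.2
  obtain ⟨C, hC⟩ := hbdd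
  have hlim : ∀ x, ∃ c, Tendsto (fun n => T n x) atTop (𝓝 c) := fun x =>
    cauchySeq_tendsto_of_complete (cauchySeq_apply_of_dense hC hdense (fun u hu =>
      (hspan u hu).choose_spec.1.cauchySeq) x)
  choose S₀ hS₀ using hlim
  -- Continuity of the pointwise limit is the Banach–Steinhaus theorem.
  let S : X →L[ℂ] X := continuousLinearMapOfTendsto (g := T) (tendsto_pi_nhds.2 hS₀)
  refine ⟨S, hΨ.funCalcEq hω hG (Gf := Gf) rfl fun x => ?_, hS₀⟩
  -- Both `Ψ(G) S` and `Ψ(G f)` are continuous, so agreement on the dense span is enough.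
  refine congrFun (Continuous.ext_on hdense ((Ψ G).continuous.comp S.continuous)
    (Ψ Gf).continuous fun u hu => ?_) x
  obtain ⟨c, hc, hc'⟩ := hspan u hu
  have : S u = c := tendsto_nhds_unique (hS₀ u) hc
  rw [Function.comp_apply, this, hc']

end IsBoundedCalculus

end HorCalc

end

theorem mainTheorem12 {X : Type*} [NormedAddCommGroup X] [NormedSpace ℂ X] [CompleteSpace X]
    (ω : ℝ) (hω : 0 ≤ ω) (v : ℝ → ℝ) (hv : HorCalc.StronglyAdmissible v)
    (A : X →ₗ.[ℂ] X) (hA : HorCalc.HasBoundedSobolevCalculus hv ω A)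
    (f : HorCalc.strip ω → ℂ) (hf : f ∈ HorCalc.horSpace v ω)
    (F : ℕ → HorCalc.strip ω → ℂ) (hF : ∀ n, F n ∈ HorCalc.horSpace v ω)
    (D : Set (ℂ → ℂ)) (hD : D ⊆ HorCalc.holSchwartzGerm ω) (hample : HorCalc.Ample ω A D)
    (hconv : ∀ ψ ∈ D, Tendsto
      (fun n => HorCalc.sobolevNorm v ω (HorCalc.toStrip ω ψ * (F n - f))) atTop (𝓝 0))
    (T : ℕ → X →L[ℂ] X) (hT : ∀ n, HorCalc.FunCalcEq hv ω A (F n) (T n))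
    (hbdd : ∃ C : ℝ, ∀ n, ‖T n‖ ≤ C) :
    ∃ S : X →L[ℂ] X, HorCalc.FunCalcEq hv ω A f S ∧
      ∀ x : X, Tendsto (fun n => T n x) atTop (𝓝 (S x)) := by
  obtain ⟨Ψ, h1, h2, h3⟩ := hA
  exact HorCalc.IsBoundedCalculus.convergence_lemma (Ψ := Ψ) ⟨h1, h2, h3⟩ hω hf hF hample hconv hT
    hbdd
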